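/- **Conventions.** The language of first-order arithmetic has $0,S,+,\times,=,\le$. Pre-terms are built from variables $v_0,v_1,\dots$; pre-formulas are built from literals $Rst,\neg Rst$ (with $R$ one of $=,\le$) by $\land,\lor$ and quantifiers $\forall v_{2i},\exists v_{2i}$ (negation normal form; only variables of even index are quantified). Terms and formulas are pre-terms and pre-formulas in which no variable of even index is free (literals are formulas of the form $Rst$ or $\neg Rst$), and sentences are formulas without free variables. Negation $\neg\varphi$ is the defined operation by de Morgan's laws, and $\varphi\to\psi$ is $\neg\varphi\lor\psi$. Write $\forall x\le t\,\varphi$ for $\forall x(x\le t\to\varphi)$ and $\exists x\le t\,\varphi$ for $\exists x(x\le t\land\varphi)$, where $x\notin\mathrm{FV}(t)$; these quantifiers are called bounded, all others unbounded. $\Sigma$-formulas are generated from literals by $\land,\lor$, bounded quantifiers and $\exists$; bounded formulas are generated without unbounded $\exists$; a $\Sigma_1$-formula has the form $\exists x\,\theta$ with $\theta$ bounded (in all three notions subformulas are allowed to be pre-formulas). A sequent is a finite set of formulas. *Provability.* $\vdash\Gamma$ is the usual one-sided sequent calculus for first-order logic with cut: axioms (sequents containing a literal and its negation); from $\Gamma,\varphi$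 and $\Gamma,\psi$ infer $\Gamma,\varphi\land\psi$; from $\Gamma,\varphi$ infer $\Gamma,\varphi\lor\psi$ and $\Gamma,\psi\lor\varphi$; from $\Gamma',\varphi[x/y]$ with $\Gamma'\subseteq\Gamma$ and $y\notin\mathrm{FV}(\Gamma',\forall x\varphi)$ infer $\Gamma,\forall x\,\varphi$; from $\Gamma,\varphi[x/t]$ with a term $t$ infer $\Gamma,\exists x\,\varphi$; from $\Gamma,\varphi$ and $\Gamma,\neg\varphi$ infer $\Gamma$. For a set $\mathsf T$ of sentences, $\mathsf T\vdash\varphi$ means $\vdash\neg\theta_1,\dots,\neg\theta_n,\varphi$ for finitely many $\theta_i\in\mathsf T$. *Theories.* $\mathsf Q$ consists of the equality axioms and the universal closures of $Sx=Sy\to x=y$, $x\ne0\leftrightarrow\exists y\,x=Sy$, $x\le y\leftrightarrow\exists z\,z+x=y$, $x+0=x$, $x+Sy=S(x+y)$, $x\times0=0$, $x\times Sy=(x\times y)+x$. $\mathsf{I\Sigma}_1$ is $\mathsf Q$ together with the universal closures of $\varphi(0)\land\forall x(\varphi(x)\to\varphi(Sx))\to\forall x\,\varphi(x)$ for all $\Sigma_1$-formulas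 $\varphi(x)$, possibly with parameters. $\mathsf Q'$ is $\mathsf Q$ with the axiom for $\le$ replaced by $\forall x,y\big((x\le y\to\exists z\le y\;z+x=y)\land(\exists z\;z+x=y\to x\le y)\big)$. *The calculus $\vdash^{\mathsf{IR}}$.* $\vdash^{\mathsf{IR}}\Gamma$ is defined by the clauses for $\vdash\Gamma$, with cut restricted to $\Sigma$-formulas, and with the induction rule: if $\vdash^{\mathsf{IR}}\Gamma',\neg\varphi[x/y],\varphi[x/Sy]$ with $\Gamma'\subseteq\Gamma$, $\varphi$ a $\Sigma$-formula and $y\notin\mathrm{FV}(\Gamma',\forall x\,\varphi)$, then $\vdash^{\mathsf{IR}}\Gamma,\neg\varphi[x/0],\varphi[x/t]$ for every term $t$. *Asymmetric interpretation.* $\varphi^{m,n}$ results from $\varphi$ by replacing each unbounded $\forall x$ by $\forall x\le\overline m$ and each unbounded $\exists x$ by $\exists x\le\overline n$ (with numerals $\overline m,\overline n$), leaving bounded quantifiers unchanged. For $g:\mathbb N\to\mathbb N$, write $\vDash^g\varphi$ if for all $m$ and all assignments $\eta:\mathbb N\to\{0,\dots,m\}$ we have $\mathbb N,\eta\vDash\varphi^{m,g(m)}$.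 *Provably total functions.* $f:\mathbb N\to\mathbb N$ is $\mathsf T$-provably total if $\mathsf T\vdash\forall x\exists y\,\varphi(x,y)$ for some $\Sigma_1$-formula $\varphi$ that defines $f$, i.e. $f(a)=b\Leftrightarrow\mathbb N\vDash\varphi(a,b)$ for all $a,b\in\mathbb N$. **Theorem.** 1. If $\mathsf{I\Sigma}_1\vdash\psi$, then $\vdash^{\mathsf{IR}}\neg\theta_1,\dots,\neg\theta_n,\psi$ for suitable (finitely many) axioms $\theta_i$ of $\mathsf Q'$. 2. If $\vdash^{\mathsf{IR}}\Gamma$, then $\vDash^g\bigvee\Gamma$ for some primitive recursive $g:\mathbb N\to\mathbb N$. 3. If $f:\mathbb N\to\mathbb N$ is $\mathsf{I\Sigma}_1$-provably total, then $f$ is primitive recursive; in particular there is a primitive recursive $g$ with $f(n)\le g(n)$ for all $n$. -/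

import Mathlib

namespace FOArith

/-- Pre-terms over the signature `0, S, +, ×` of first-order arithmetic; `var n` is the variable
`v_n`. -/
inductive PreTerm : Type
  | var (n : ℕ)
  | zero
  | succ (t : PreTerm)
  | add (s t : PreTerm)
  | mul (s t : PreTerm)
  deriving DecidableEq

/-- The two binary relation symbols `=` and `≤`. -/
inductive RelSym : Type
  | eq
  | le
  deriving DecidableEq

/-- Pre-formulas in negation normal form. `atom R s t` is `R s t`, `natom R s t` is `¬ R s t`.
Only variables of even index can be quantified: `all i φ` is `∀ v_{2i} φ` and `ex i φ` is
`∃ v_{2i} φ`. -/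
inductive PreFormula : Type
  | atom (R : RelSym) (s t : PreTerm)
  | natom (R : RelSym) (s t : PreTerm)
  | and (φ ψ : PreFormula)
  | or (φ ψ : PreFormula)
  | all (i : ℕ) (φ : PreFormula)
  | ex (i : ℕ) (φ : PreFormula)
  deriving DecidableEq

namespace PreTerm

/-- Indices of the variables that occur in a pre-term. -/
def fv : PreTerm → Finset ℕ
  | var n => {n}
  | zero => ∅
  | succ t => t.fv
  | add s t => s.fv ∪ t.fv
  | mul s t => s.fv ∪ t.fv

/-- `s.subst k u` is `s[v_k/u]`. -/
def subst : PreTerm → ℕ → PreTerm → PreTerm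
  | var n, k, u => if n = k then u else var n
  | zero, _, _ => zero
  | succ t, k, u => succ (t.subst k u)
  | add s t, k, u => add (s.subst k u) (t.subst k u)
  | mul s t, k, u => mul (s.subst k u) (t.subst k u)

/-- A term is a pre-term without variables of even index. -/
def IsTerm (t : PreTerm) : Prop := ∀ i : ℕ, 2 * i ∉ t.fv

/-- The numeral of `n`. -/
def numeral : ℕ → PreTerm
  | 0 => zero
  | n + 1 => succ (numeral n)

/-- The value of a pre-term in the standard model under the assignment `η`. -/
def val (η : ℕ → ℕ) : PreTerm → ℕ
  | var n => η n
  | zero => 0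
  | succ t => val η t + 1
  | add s t => val η s + val η t
  | mul s t => val η s * val η t

end PreTerm

/-- The interpretation of the relation symbols in the standard model. -/
def RelSym.Holds : RelSym → ℕ → ℕ → Prop
  | eq, a, b => a = b
  | le, a, b => a ≤ b

namespace PreFormula

/-- Negation, as an operation on pre-formulas in negation normal form. -/
def neg : PreFormula → PreFormula
  | atom R s t => natom R s t
  | natom R s t => atom R s t
  | and φ ψ => or (neg φ) (neg ψ)
  | or φ ψ => and (neg φ) (neg ψ)
  | all i φ => ex i (neg φ)
  | ex i φ => all i (neg φ)

/-- `φ → ψ` abbreviates `¬φ ∨ ψ`. -/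
def imp (φ ψ : PreFormula) : PreFormula := or (neg φ) ψ

/-- `φ ↔ ψ` abbreviates `(φ → ψ) ∧ (ψ → φ)`. -/
def iff (φ ψ : PreFormula) : PreFormula := and (imp φ ψ) (imp ψ φ)

/-- The formula `s = t`. -/
def eqF (s t : PreTerm) : PreFormula := atom RelSym.eq s t

/-- The formula `s ≤ t`. -/
def leF (s t : PreTerm) : PreFormula := atom RelSym.le s t

/-- `∀ v_{2i} ≤ t φ`, that is `∀ v_{2i} (v_{2i} ≤ t → φ)`. -/
def ball (i : ℕ) (t : PreTerm) (φ : PreFormula) : PreFormula :=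
  all i (imp (leF (PreTerm.var (2 * i)) t) φ)

/-- `∃ v_{2i} ≤ t φ`, that is `∃ v_{2i} (v_{2i} ≤ t ∧ φ)`. -/
def bex (i : ℕ) (t : PreTerm) (φ : PreFormula) : PreFormula :=
  ex i (and (leF (PreTerm.var (2 * i)) t) φ)

/-- `∀ v_{2i₁} … ∀ v_{2iₖ} φ` for a list `i₁, …, iₖ`. -/
def alls (L : List ℕ) (φ : PreFormula) : PreFormula := L.foldr all φ

/-- Indices of the free variables. -/
def fv : PreFormula → Finset ℕ
  | atom _ s t => s.fv ∪ t.fv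
  | natom _ s t => s.fv ∪ t.fv
  | and φ ψ => φ.fv ∪ ψ.fv
  | or φ ψ => φ.fv ∪ ψ.fv
  | all i φ => φ.fv.erase (2 * i)
  | ex i φ => φ.fv.erase (2 * i)

/-- `φ.subst k u` is `φ[v_k/u]`. It is capture-free when `u` is a term, and also when `u` contains
no variable of even index except possibly `v_k` itself. -/
def subst : PreFormula → ℕ → PreTerm → PreFormula
  | atom R s t, k, u => atom R (s.subst k u) (t.subst k u)
  | natom R s t, k, u => natom R (s.subst k u) (t.subst k u)
  | and φ ψ, k, u => and (φ.subst k u) (ψ.subst k u)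
  | or φ ψ, k, u => or (φ.subst k u) (ψ.subst k u)
  | all i φ, k, u => if k = 2 * i then all i φ else all i (φ.subst k u)
  | ex i φ, k, u => if k = 2 * i then ex i φ else ex i (φ.subst k u)

/-- A formula is a pre-formula in which no variable of even index is free. -/
def IsFormula (φ : PreFormula) : Prop := ∀ i : ℕ, 2 * i ∉ φ.fv

/-- A literal is a formula `R s t` or `¬ R s t`. -/
def IsLiteral : PreFormula → Prop
  | atom R s t => IsFormula (atom R s t)
  | natom R s t => IsFormula (natom R s t)
  | _ => False

/-- `φ.TrueAt η`: the standard model satisfies `φ` under the assignment `η`. -/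
def TrueAt : PreFormula → (ℕ → ℕ) → Prop
  | atom R s t, η => R.Holds (s.val η) (t.val η)
  | natom R s t, η => ¬ R.Holds (s.val η) (t.val η)
  | and φ ψ, η => φ.TrueAt η ∧ ψ.TrueAt η
  | or φ ψ, η => φ.TrueAt η ∨ ψ.TrueAt η
  | all i φ, η => ∀ a : ℕ, φ.TrueAt (Function.update η (2 * i) a)
  | ex i φ, η => ∃ a : ℕ, φ.TrueAt (Function.update η (2 * i) a)

/-- Bounded (`Δ₀`) pre-formulas. -/
inductive IsDeltaZero : PreFormula → Prop
  | atom (R : RelSym) (s t : PreTerm) : IsDeltaZero (atom R s t)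
  | natom (R : RelSym) (s t : PreTerm) : IsDeltaZero (natom R s t)
  | and {φ ψ : PreFormula} : IsDeltaZero φ → IsDeltaZero ψ → IsDeltaZero (and φ ψ)
  | or {φ ψ : PreFormula} : IsDeltaZero φ → IsDeltaZero ψ → IsDeltaZero (or φ ψ)
  | ball {φ : PreFormula} (i : ℕ) (t : PreTerm) :
      2 * i ∉ t.fv → IsDeltaZero φ → IsDeltaZero (ball i t φ)
  | bex {φ : PreFormula} (i : ℕ) (t : PreTerm) :
      2 * i ∉ t.fv → IsDeltaZero φ → IsDeltaZero (bex i t φ)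

/-- `Σ` pre-formulas. -/
inductive IsSigma : PreFormula → Prop
  | atom (R : RelSym) (s t : PreTerm) : IsSigma (atom R s t)
  | natom (R : RelSym) (s t : PreTerm) : IsSigma (natom R s t)
  | and {φ ψ : PreFormula} : IsSigma φ → IsSigma ψ → IsSigma (and φ ψ)
  | or {φ ψ : PreFormula} : IsSigma φ → IsSigma ψ → IsSigma (or φ ψ)
  | ball {φ : PreFormula} (i : ℕ) (t : PreTerm) :
      2 * i ∉ t.fv → IsSigma φ → IsSigma (ball i t φ)
  | bex {φ : PreFormula} (i : ℕ) (t : PreTerm) :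
      2 * i ∉ t.fv → IsSigma φ → IsSigma (bex i t φ)
  | ex {φ : PreFormula} (i : ℕ) : IsSigma φ → IsSigma (ex i φ)

/-- `Σ₁` pre-formulas: `∃ x θ` with bounded `θ`. -/
def IsSigmaOne (φ : PreFormula) : Prop :=
  ∃ (i : ℕ) (θ : PreFormula), IsDeltaZero θ ∧ φ = ex i θ

/-- `isBoundedAll i φ`: the pre-formula `∀ v_{2i} φ` is a bounded quantification, that is,
`φ` has the form `v_{2i} ≤ t → ψ` where `v_{2i}` does not occur in `t`. -/
def isBoundedAll (i : ℕ) : PreFormula → Bool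
  | or (natom RelSym.le (PreTerm.var k) t) _ => decide (k = 2 * i ∧ 2 * i ∉ t.fv)
  | _ => false

/-- `isBoundedEx i φ`: the pre-formula `∃ v_{2i} φ` is a bounded quantification, that is,
`φ` has the form `v_{2i} ≤ t ∧ ψ` where `v_{2i}` does not occur in `t`. -/
def isBoundedEx (i : ℕ) : PreFormula → Bool
  | and (atom RelSym.le (PreTerm.var k) t) _ => decide (k = 2 * i ∧ 2 * i ∉ t.fv)
  | _ => false

/-- The asymmetric interpretation `φ^{m,n}`: unbounded universal quantifiers are bounded by the
numeral of `m` and unbounded existential quantifiers by the numeral of `n`, while bounded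
quantifiers are unaffected (literals coincide with their interpretation, so that
`(x ≤ t → ψ)^{m,n}` is `x ≤ t → ψ^{m,n}`, and similarly for conjunctions). -/
def asym (m n : ℕ) : PreFormula → PreFormula
  | atom R s t => atom R s t
  | natom R s t => natom R s t
  | and φ ψ => and (asym m n φ) (asym m n ψ)
  | or φ ψ => or (asym m n φ) (asym m n ψ)
  | all i φ =>
      if isBoundedAll i φ then all i (asym m n φ)
      else ball i (PreTerm.numeral m) (asym m n φ)
  | ex i φ =>
      if isBoundedEx i φ then ex i (asym m n φ)
      else bex i (PreTerm.numeral n) (asym m n φ)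

/-- `⊨^{m,n} φ`. -/
def AsymTrue (m n : ℕ) (φ : PreFormula) : Prop :=
  ∀ η : ℕ → ℕ, (∀ i, η i ≤ m) → (asym m n φ).TrueAt η

/-- `⊨^g φ`. -/
def AsymTrueFun (g : ℕ → ℕ) (φ : PreFormula) : Prop :=
  ∀ m : ℕ, AsymTrue m (g m) φ

/-- The matrix `φ(0) ∧ ∀x (φ(x) → φ(Sx)) → ∀x φ(x)` of the induction axiom for `φ` with respect
to the variable `x = v_{2j}`. -/
def indMatrix (j : ℕ) (φ : PreFormula) : PreFormula :=
  imp (and (φ.subst (2 * j) PreTerm.zero)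
        (all j (imp φ (φ.subst (2 * j) (PreTerm.succ (PreTerm.var (2 * j)))))))
    (all j φ)

end PreFormula

open PreFormula

/-- A sequent is a finite set of formulas. -/
def IsSequent (Γ : Finset PreFormula) : Prop := ∀ φ ∈ Γ, φ.IsFormula

/-- The free variables of a finite set of formulas. -/
def seqFV (Γ : Finset PreFormula) : Finset ℕ := Γ.biUnion fv

/-- The disjunction over the formulas in a sequent; the final disjunct `¬ 0 = 0` stands for the
empty disjunction. -/
noncomputable def bigOr (Γ : Finset PreFormula) : PreFormula :=
  Γ.toList.foldr or (natom RelSym.eq PreTerm.zero PreTerm.zero)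

/-- The sequent calculus of first-order logic (with cut), `⊢ Γ`. -/
inductive Derivable : Finset PreFormula → Prop
  | ax {Γ : Finset PreFormula} (φ : PreFormula) :
      IsSequent Γ → φ.IsLiteral → φ ∈ Γ → φ.neg ∈ Γ → Derivable Γ
  | and {Γ : Finset PreFormula} {φ ψ : PreFormula} :
      Derivable (insert φ Γ) → Derivable (insert ψ Γ) → Derivable (insert (and φ ψ) Γ)
  | orLeft {Γ : Finset PreFormula} {ψ θ : PreFormula} :
      θ.IsFormula → Derivable (insert ψ Γ) → Derivable (insert (or ψ θ) Γ)
  | orRight {Γ : Finset PreFormula} {φ ψ : PreFormula} :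
      φ.IsFormula → Derivable (insert ψ Γ) → Derivable (insert (or φ ψ) Γ)
  | all {Γ Γ₀ : Finset PreFormula} {φ : PreFormula} {i : ℕ} (k : ℕ) :
      IsSequent (insert (all i φ) Γ) → Γ₀ ⊆ Γ →
      2 * k + 1 ∉ seqFV (insert (all i φ) Γ₀) →
      Derivable (insert (φ.subst (2 * i) (PreTerm.var (2 * k + 1))) Γ₀) →
      Derivable (insert (all i φ) Γ)
  | ex {Γ : Finset PreFormula} {φ : PreFormula} {i : ℕ} (t : PreTerm) :
      IsSequent (insert (ex i φ) Γ) → t.IsTerm →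
      Derivable (insert (φ.subst (2 * i) t) Γ) → Derivable (insert (ex i φ) Γ)
  | cut {Γ : Finset PreFormula} (φ : PreFormula) :
      φ.IsFormula → Derivable (insert φ Γ) → Derivable (insert φ.neg Γ) → Derivable Γ

/-- `Θ ⊢ φ`: there are finitely many `θ₁, …, θₙ ∈ Θ` with `⊢ ¬θ₁, …, ¬θₙ, φ`. -/
def Proves (Θ : Set PreFormula) (φ : PreFormula) : Prop :=
  ∃ T : Finset PreFormula, (T : Set PreFormula) ⊆ Θ ∧ Derivable (insert φ (T.image neg))

/-- The calculus `⊢^{IR} Γ` with cuts over `Σ`-formulas and the `Σ`-induction rule. -/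
inductive DerivableIR : Finset PreFormula → Prop
  | ax {Γ : Finset PreFormula} (φ : PreFormula) :
      IsSequent Γ → φ.IsLiteral → φ ∈ Γ → φ.neg ∈ Γ → DerivableIR Γ
  | and {Γ : Finset PreFormula} {φ ψ : PreFormula} :
      DerivableIR (insert φ Γ) → DerivableIR (insert ψ Γ) → DerivableIR (insert (and φ ψ) Γ)
  | orLeft {Γ : Finset PreFormula} {ψ θ : PreFormula} :
      θ.IsFormula → DerivableIR (insert ψ Γ) → DerivableIR (insert (or ψ θ) Γ)
  | orRight {Γ : Finset PreFormula} {φ ψ : PreFormula} :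
      φ.IsFormula → DerivableIR (insert ψ Γ) → DerivableIR (insert (or φ ψ) Γ)
  | all {Γ Γ₀ : Finset PreFormula} {φ : PreFormula} {i : ℕ} (k : ℕ) :
      IsSequent (insert (all i φ) Γ) → Γ₀ ⊆ Γ →
      2 * k + 1 ∉ seqFV (insert (all i φ) Γ₀) →
      DerivableIR (insert (φ.subst (2 * i) (PreTerm.var (2 * k + 1))) Γ₀) →
      DerivableIR (insert (all i φ) Γ)
  | ex {Γ : Finset PreFormula} {φ : PreFormula} {i : ℕ} (t : PreTerm) :
      IsSequent (insert (ex i φ) Γ) → t.IsTerm →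
      DerivableIR (insert (φ.subst (2 * i) t) Γ) → DerivableIR (insert (ex i φ) Γ)
  | sigmaCut {Γ : Finset PreFormula} (φ : PreFormula) :
      φ.IsFormula → φ.IsSigma →
      DerivableIR (insert φ Γ) → DerivableIR (insert φ.neg Γ) → DerivableIR Γ
  | ir {Γ Γ₀ : Finset PreFormula} (φ : PreFormula) (i k : ℕ) (t : PreTerm) :
      φ.IsSigma → (PreFormula.all i φ).IsFormula → t.IsTerm → IsSequent Γ → Γ₀ ⊆ Γ →
      2 * k + 1 ∉ seqFV (insert (PreFormula.all i φ) Γ₀) →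
      DerivableIR (insert (φ.subst (2 * i) (PreTerm.var (2 * k + 1))).neg
        (insert (φ.subst (2 * i) (PreTerm.succ (PreTerm.var (2 * k + 1)))) Γ₀)) →
      DerivableIR (insert (φ.subst (2 * i) PreTerm.zero).neg
        (insert (φ.subst (2 * i) t) Γ))

/-- The variables `v₀, v₂, v₄, v₆`, used to write down axioms. -/
abbrev x₀ : PreTerm := PreTerm.var 0
abbrev x₁ : PreTerm := PreTerm.var 2
abbrev x₂ : PreTerm := PreTerm.var 4
abbrev x₃ : PreTerm := PreTerm.var 6

/-- The equality axioms for the signature of first-order arithmetic. -/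
def equalityAxioms : Set PreFormula :=
  { alls [0] (eqF x₀ x₀),
    alls [0, 1] (imp (eqF x₀ x₁) (eqF x₁ x₀)),
    alls [0, 1, 2] (imp (and (eqF x₀ x₁) (eqF x₁ x₂)) (eqF x₀ x₂)),
    eqF PreTerm.zero PreTerm.zero,
    alls [0, 1] (imp (eqF x₀ x₁) (eqF x₀.succ x₁.succ)),
    alls [0, 1, 2, 3] (imp (and (eqF x₀ x₂) (eqF x₁ x₃)) (eqF (x₀.add x₁) (x₂.add x₃))),
    alls [0, 1, 2, 3] (imp (and (eqF x₀ x₂) (eqF x₁ x₃)) (eqF (x₀.mul x₁) (x₂.mul x₃))),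
    alls [0, 1, 2, 3] (imp (and (eqF x₀ x₂) (eqF x₁ x₃)) (iff (eqF x₀ x₁) (eqF x₂ x₃))),
    alls [0, 1, 2, 3] (imp (and (eqF x₀ x₂) (eqF x₁ x₃)) (iff (leF x₀ x₁) (leF x₂ x₃))) }

/-- The axioms of Robinson arithmetic other than the equality axioms and the one about `≤`. -/
def robinsonCore : Set PreFormula :=
  { alls [0, 1] (imp (eqF x₀.succ x₁.succ) (eqF x₀ x₁)),
    alls [0] (iff (eqF x₀ PreTerm.zero).neg (ex 1 (eqF x₀ x₁.succ))),
    alls [0] (eqF (x₀.add PreTerm.zero) x₀),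
    alls [0, 1] (eqF (x₀.add x₁.succ) (x₀.add x₁).succ),
    alls [0] (eqF (x₀.mul PreTerm.zero) PreTerm.zero),
    alls [0, 1] (eqF (x₀.mul x₁.succ) ((x₀.mul x₁).add x₀)) }

/-- Robinson arithmetic `Q`; the added axiom is `∀x,y (x ≤ y ↔ ∃z z + x = y)`. -/
def robinsonQ : Set PreFormula :=
  equalityAxioms ∪ robinsonCore ∪
    {alls [0, 1] (iff (leF x₀ x₁) (ex 2 (eqF (x₂.add x₀) x₁)))}

/-- The variant of `Q` in which the axiom about `≤` is replaced by
`∀x,y ((x ≤ y → ∃z ≤ y z + x = y) ∧ (∃z z + x = y → x ≤ y))`. -/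
def robinsonQPrime : Set PreFormula :=
  equalityAxioms ∪ robinsonCore ∪
    {alls [0, 1] (and (imp (leF x₀ x₁) (bex 2 x₁ (eqF (x₂.add x₀) x₁)))
      (imp (ex 2 (eqF (x₂.add x₀) x₁)) (leF x₀ x₁)))}

/-- The induction axioms for `Σ₁`-formulas `φ(x)`, possibly with parameters: all universal closures
of the matrices `φ(0) ∧ ∀x (φ(x) → φ(Sx)) → ∀x φ(x)`. The list `L` enumerates the free variables
(the parameters), which are written with even indices as they are quantified. -/
def sigmaOneInduction : Set PreFormula :=
  { σ | ∃ (φ : PreFormula) (j : ℕ) (L : List ℕ), φ.IsSigmaOne ∧ L.Nodup ∧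
      (∀ n : ℕ, n ∈ (indMatrix j φ).fv ↔ ∃ i ∈ L, n = 2 * i) ∧
      σ = alls L (indMatrix j φ) }

/-- The theory `IΣ₁`. -/
def ISigmaOne : Set PreFormula := robinsonQ ∪ sigmaOneInduction

/-- `f` is `T`-provably total: `T ⊢ ∀x ∃y φ(x,y)` for some `Σ₁`-formula `φ(x,y)` that defines `f`,
where `x = v_{2i}` and `y = v_{2j}` are the only free variables of `φ`. -/
def ProvablyTotal (T : Set PreFormula) (f : ℕ → ℕ) : Prop :=
  ∃ (φ : PreFormula) (i j : ℕ), i ≠ j ∧ φ.IsSigmaOne ∧ φ.fv ⊆ {2 * i, 2 * j} ∧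
    (∀ (a b : ℕ) (η : ℕ → ℕ), η (2 * i) = a → η (2 * j) = b → (f a = b ↔ φ.TrueAt η)) ∧
    Proves T (all i (ex j φ))

end FOArith

/-!
# Provably total functions of `IΣ₁` are primitive recursive

The first claim is a partial cut elimination. The `Σ₁`-induction axioms are derivable with the
induction rule, and all other axioms of `IΣ₁` follow from those of `Q'`, so a proof in `IΣ₁` becomes
a derivation from `Q'` with the induction rule and with arbitrary cuts. The principal formulas of
literal axioms and of the induction rule are `Σ` up to negation; hence a cut on any other formula can
be reduced to its immediate subformulas in the usual way (`Deriv.remove`, `Deriv.cut_reduction`,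
`Deriv.cut_elimination`). To avoid the renaming of eigenvariables, this is carried out in the calculus
`Deriv`, whose rule for `∀` and whose induction rule have a premise for each term. Finite derivations
are translated into it by applying all substitutions of terms for free variables simultaneously
(`Derivable.exists_deriv`); a fresh variable as the term leads back (`Deriv.derivableIR`).

The second claim is an induction over derivations (`DerivableIR.exists_seqTrue`). It rests on the
facts that negation swaps the two bounds of the asymmetric interpretation (`trueAt_asym_neg`), that
truth is preserved when the bound for `∀` decreases and the one for `∃` increases
(`trueAt_asym_mono`), and that the bound for `∀` is irrelevant in `Σ`-formulas. Thus cuts compose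
bounds (`SeqTrue.cut`), and the induction rule iterates the bound of its premise (`SeqTrue.ir`). A
bounded quantifier `∀ x ≤ t` can range beyond the bound `m` on the assignments, so the premise is
then used with a bound that also majorizes `t` (`exists_primrec_relevant`).

For the third claim, the axiom of `Q'` about predecessors is an obstacle, since
`x ≠ 0 → ∃ y x = Sy` fails under the asymmetric interpretation for large `x`. The partial cut
elimination is therefore applied with `robinsonBounded`, where this quantifier is bounded by `x`;
these axioms are true for all bounds, so that a derivation of `∀ x ∃ y φ(x, y)` from them bounds
`y = f(x)` and the remaining witnesses by a primitive recursive `g(x)`. As `Σ`-formulas with bounded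
witnesses define primitive recursive relations (`PreFormula.IsSigma.primrecPred`), `f` arises from a
bounded search.
-/

namespace FOArith

/-! ### Substitution, negation and free variables -/

namespace PreTerm

theorem subst_of_notMem {t : PreTerm} {k : ℕ} (h : k ∉ t.fv) (u : PreTerm) : t.subst k u = t := by
  induction t with
  | var n => simp_all [fv, subst, eq_comm]
  | zero => rfl
  | succ t ih => simp_all [fv, subst]
  | add s t ihs iht => simp_all [fv, subst]
  | mul s t ihs iht => simp_all [fv, subst]

theorem IsTerm.subst_eq {t : PreTerm} (h : t.IsTerm) (i : ℕ) (u : PreTerm) :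
    t.subst (2 * i) u = t :=
  subst_of_notMem (h i) u

theorem isTerm_var (k : ℕ) : (var (2 * k + 1)).IsTerm := by
  intro i
  simp only [fv, Finset.mem_singleton]
  omega

theorem isTerm_zero : zero.IsTerm := by
  intro i
  simp [fv]

theorem IsTerm.succ {t : PreTerm} (h : t.IsTerm) : t.succ.IsTerm := h

theorem mem_fv_subst {t : PreTerm} {k n : ℕ} {u : PreTerm} (h : n ∈ (t.subst k u).fv) :
    n ∈ t.fv ∧ n ≠ k ∨ n ∈ u.fv := by
  induction t with
  | var m =>
    by_cases hm : m = k
    · simp_all [subst]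
    · simp_all [subst, fv]
  | zero => simp [subst, fv] at h
  | succ t ih => exact ih h
  | add s t ihs iht =>
    simp only [subst, fv, Finset.mem_union] at h ⊢
    tauto
  | mul s t ihs iht =>
    simp only [subst, fv, Finset.mem_union] at h ⊢
    tauto

theorem subst_comm {a b : ℕ} {u w : PreTerm} (hab : a ≠ b) (hu : b ∉ u.fv) (hw : a ∉ w.fv)
    (t : PreTerm) : (t.subst a u).subst b w = (t.subst b w).subst a u := by
  induction t with
  | var n =>
    by_cases ha : n = a
    · subst ha
      simp [subst, hab, subst_of_notMem hu]
    · by_cases hb : n = b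
      · subst hb
        simp [subst, ha, subst_of_notMem hw]
      · simp [subst, ha, hb]
  | zero => rfl
  | succ t ih => simp [subst, ih]
  | add s t ihs iht => simp [subst, ihs, iht]
  | mul s t ihs iht => simp [subst, ihs, iht]

theorem subst_subst_same (k : ℕ) (u w : PreTerm) (t : PreTerm) :
    (t.subst k u).subst k w = t.subst k (u.subst k w) := by
  induction t with
  | var n => by_cases h : n = k <;> simp [subst, h]
  | zero => rfl
  | succ t ih => simp [subst, ih]
  | add s t ihs iht => simp [subst, ihs, iht]
  | mul s t ihs iht => simp [subst, ihs, iht]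

/-- Simultaneous substitution of `σ n` for every variable `v_n`. -/
def msubst (σ : ℕ → PreTerm) : PreTerm → PreTerm
  | var n => σ n
  | zero => zero
  | succ t => succ (t.msubst σ)
  | add s t => add (s.msubst σ) (t.msubst σ)
  | mul s t => mul (s.msubst σ) (t.msubst σ)

theorem msubst_congr {σ τ : ℕ → PreTerm} {t : PreTerm} (h : ∀ n ∈ t.fv, σ n = τ n) :
    t.msubst σ = t.msubst τ := by
  induction t with
  | var n => exact h n (by simp [fv])
  | zero => rfl
  | succ t ih => simp only [msubst, ih h]
  | add s t ihs iht =>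
    simp only [fv, Finset.mem_union] at h
    simp only [msubst, ihs fun n hn => h n (.inl hn), iht fun n hn => h n (.inr hn)]
  | mul s t ihs iht =>
    simp only [fv, Finset.mem_union] at h
    simp only [msubst, ihs fun n hn => h n (.inl hn), iht fun n hn => h n (.inr hn)]

theorem msubst_var (t : PreTerm) : t.msubst var = t := by
  induction t <;> simp_all [msubst]

end PreTerm

/-- A simultaneous substitution that fixes the variables of even index, which may be bound, and
replaces those of odd index by terms. Such substitutions are always capture-free. -/
structure IsTermSubst (σ : ℕ → PreTerm) : Prop where
  even (i : ℕ) : σ (2 * i) = PreTerm.var (2 * i)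
  odd (k : ℕ) : (σ (2 * k + 1)).IsTerm

theorem isTermSubst_var : IsTermSubst PreTerm.var :=
  ⟨fun _ => rfl, PreTerm.isTerm_var⟩

theorem IsTermSubst.update {σ : ℕ → PreTerm} (h : IsTermSubst σ) (k : ℕ) {t : PreTerm}
    (ht : t.IsTerm) : IsTermSubst (Function.update σ (2 * k + 1) t) where
  even i := by rw [Function.update_of_ne (by omega), h.even]
  odd l := by
    by_cases hl : l = k
    · subst hl
      simpa using ht
    · rw [Function.update_of_ne (by omega)]
      exact h.odd l

namespace PreTerm

theorem even_mem_fv_msubst {σ : ℕ → PreTerm} (hσ : IsTermSubst σ) {t : PreTerm} {i : ℕ}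
    (h : 2 * i ∈ (t.msubst σ).fv) : 2 * i ∈ t.fv := by
  induction t with
  | var n =>
    rcases Nat.even_or_odd' n with ⟨m, rfl | rfl⟩
    · simpa [msubst, hσ.even, fv] using h
    · exact absurd h (hσ.odd m i)
  | zero => exact h
  | succ t ih => exact ih h
  | add s t ihs iht =>
    simp only [msubst, fv, Finset.mem_union] at h ⊢
    tauto
  | mul s t ihs iht =>
    simp only [msubst, fv, Finset.mem_union] at h ⊢
    tauto

theorem IsTerm.msubst {t : PreTerm} (ht : t.IsTerm) {σ : ℕ → PreTerm} (hσ : IsTermSubst σ) :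
    (t.msubst σ).IsTerm :=
  fun i h => ht i (even_mem_fv_msubst hσ h)

theorem msubst_subst {σ : ℕ → PreTerm} (hσ : IsTermSubst σ) (i : ℕ) (u t : PreTerm) :
    (t.subst (2 * i) u).msubst σ = (t.msubst σ).subst (2 * i) (u.msubst σ) := by
  induction t with
  | var n =>
    rcases Nat.even_or_odd' n with ⟨m, rfl | rfl⟩
    · by_cases h : 2 * m = 2 * i
      · simp [subst, msubst, hσ.even, h]
      · simp only [subst, msubst, hσ.even, h, if_false]
    · have h : 2 * m + 1 ≠ 2 * i := by omega
      simp only [subst, msubst, h, if_false, (hσ.odd m).subst_eq]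
  | zero => rfl
  | succ t ih => simp [subst, msubst, ih]
  | add s t ihs iht => simp [subst, msubst, ihs, iht]
  | mul s t ihs iht => simp [subst, msubst, ihs, iht]

end PreTerm

namespace PreFormula

@[simp] theorem neg_neg (φ : PreFormula) : φ.neg.neg = φ := by
  induction φ <;> simp_all [neg]

theorem neg_injective : Function.Injective neg :=
  Function.LeftInverse.injective neg_neg

@[simp] theorem fv_neg (φ : PreFormula) : φ.neg.fv = φ.fv := by
  induction φ <;> simp_all [neg, fv]

theorem isFormula_neg {φ : PreFormula} : φ.neg.IsFormula ↔ φ.IsFormula := by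
  simp [IsFormula]

theorem neg_subst (φ : PreFormula) (k : ℕ) (u : PreTerm) :
    (φ.subst k u).neg = φ.neg.subst k u := by
  induction φ with
  | atom R s t => rfl
  | natom R s t => rfl
  | and φ ψ ihφ ihψ => simp [neg, subst, ihφ, ihψ]
  | or φ ψ ihφ ihψ => simp [neg, subst, ihφ, ihψ]
  | all i φ ih => by_cases h : k = 2 * i <;> simp [neg, subst, ih, h]
  | ex i φ ih => by_cases h : k = 2 * i <;> simp [neg, subst, ih, h]

theorem mem_fv_subst {φ : PreFormula} {k n : ℕ} {u : PreTerm} (h : n ∈ (φ.subst k u).fv) :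
    n ∈ φ.fv ∧ n ≠ k ∨ n ∈ u.fv := by
  induction φ with
  | atom R s t =>
    simp only [subst, fv, Finset.mem_union] at h ⊢
    have hs := @PreTerm.mem_fv_subst s k n u
    have ht := @PreTerm.mem_fv_subst t k n u
    tauto
  | natom R s t =>
    simp only [subst, fv, Finset.mem_union] at h ⊢
    have hs := @PreTerm.mem_fv_subst s k n u
    have ht := @PreTerm.mem_fv_subst t k n u
    tauto
  | and φ ψ ihφ ihψ =>
    simp only [subst, fv, Finset.mem_union] at h ⊢
    tauto
  | or φ ψ ihφ ihψ =>
    simp only [subst, fv, Finset.mem_union] at h ⊢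
    tauto
  | all i φ ih =>
    by_cases hk : k = 2 * i
    · subst hk
      simp_all [subst, fv]
    · simp only [subst, hk, if_false, fv, Finset.mem_erase] at h ⊢
      tauto
  | ex i φ ih =>
    by_cases hk : k = 2 * i
    · subst hk
      simp_all [subst, fv]
    · simp only [subst, hk, if_false, fv, Finset.mem_erase] at h ⊢
      tauto

theorem isFormula_subst {φ : PreFormula} {i : ℕ} {u : PreTerm} (h : (all i φ).IsFormula)
    (hu : u.IsTerm) : (φ.subst (2 * i) u).IsFormula := by
  intro j hj
  rcases mem_fv_subst hj with ⟨h₁, h₂⟩ | h₁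
  · exact h j (Finset.mem_erase.2 ⟨h₂, h₁⟩)
  · exact hu j h₁

theorem subst_comm {a b : ℕ} {u w : PreTerm} (hab : a ≠ b) (hu : b ∉ u.fv) (hw : a ∉ w.fv)
    (φ : PreFormula) : (φ.subst a u).subst b w = (φ.subst b w).subst a u := by
  induction φ with
  | atom R s t => simp [subst, PreTerm.subst_comm hab hu hw]
  | natom R s t => simp [subst, PreTerm.subst_comm hab hu hw]
  | and φ ψ ihφ ihψ => simp [subst, ihφ, ihψ]
  | or φ ψ ihφ ihψ => simp [subst, ihφ, ihψ]
  | all i φ ih => by_cases ha : a = 2 * i <;> by_cases hb : b = 2 * i <;> simp_all [subst]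
  | ex i φ ih => by_cases ha : a = 2 * i <;> by_cases hb : b = 2 * i <;> simp_all [subst]

theorem subst_subst_same (k : ℕ) (u w : PreTerm) (φ : PreFormula) :
    (φ.subst k u).subst k w = φ.subst k (u.subst k w) := by
  induction φ with
  | atom R s t => simp [subst, PreTerm.subst_subst_same]
  | natom R s t => simp [subst, PreTerm.subst_subst_same]
  | and φ ψ ihφ ihψ => simp [subst, ihφ, ihψ]
  | or φ ψ ihφ ihψ => simp [subst, ihφ, ihψ]
  | all i φ ih => by_cases h : k = 2 * i <;> simp [subst, h, ih]
  | ex i φ ih => by_cases h : k = 2 * i <;> simp [subst, h, ih]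

/-- Simultaneous substitution of `σ n` for the free occurrences of every variable `v_n`. Bound
variables are left alone under the assumption, made wherever this is used, that `σ` fixes the
variables of even index. -/
def msubst (σ : ℕ → PreTerm) : PreFormula → PreFormula
  | atom R s t => atom R (s.msubst σ) (t.msubst σ)
  | natom R s t => natom R (s.msubst σ) (t.msubst σ)
  | and φ ψ => and (φ.msubst σ) (ψ.msubst σ)
  | or φ ψ => or (φ.msubst σ) (ψ.msubst σ)
  | all i φ => all i (φ.msubst σ)
  | ex i φ => ex i (φ.msubst σ)

theorem msubst_neg (σ : ℕ → PreTerm) (φ : PreFormula) :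
    φ.neg.msubst σ = (φ.msubst σ).neg := by
  induction φ <;> simp_all [neg, msubst]

theorem msubst_var (φ : PreFormula) : φ.msubst PreTerm.var = φ := by
  induction φ <;> simp_all [msubst, PreTerm.msubst_var]

theorem msubst_congr {σ τ : ℕ → PreTerm} (hσ : IsTermSubst σ) (hτ : IsTermSubst τ)
    {φ : PreFormula} (h : ∀ n ∈ φ.fv, σ n = τ n) : φ.msubst σ = φ.msubst τ := by
  induction φ with
  | atom R s t =>
    simp only [fv, Finset.mem_union] at h
    simp only [msubst, PreTerm.msubst_congr fun n hn => h n (.inl hn),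
      PreTerm.msubst_congr fun n hn => h n (.inr hn)]
  | natom R s t =>
    simp only [fv, Finset.mem_union] at h
    simp only [msubst, PreTerm.msubst_congr fun n hn => h n (.inl hn),
      PreTerm.msubst_congr fun n hn => h n (.inr hn)]
  | and φ ψ ihφ ihψ =>
    simp only [fv, Finset.mem_union] at h
    simp only [msubst, ihφ fun n hn => h n (.inl hn), ihψ fun n hn => h n (.inr hn)]
  | or φ ψ ihφ ihψ =>
    simp only [fv, Finset.mem_union] at h
    simp only [msubst, ihφ fun n hn => h n (.inl hn), ihψ fun n hn => h n (.inr hn)]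
  | all i φ ih | ex i φ ih =>
    simp only [msubst]
    rw [ih]
    intro n hn
    by_cases hi : n = 2 * i
    · rw [hi, hσ.even, hτ.even]
    · exact h n (Finset.mem_erase.2 ⟨hi, hn⟩)

theorem msubst_update {σ : ℕ → PreTerm} (hσ : IsTermSubst σ) {k : ℕ} {t : PreTerm}
    (ht : t.IsTerm) {φ : PreFormula} (h : 2 * k + 1 ∉ φ.fv) :
    φ.msubst (Function.update σ (2 * k + 1) t) = φ.msubst σ := by
  refine msubst_congr (hσ.update k ht) hσ fun n hn => Function.update_of_ne ?_ _ _
  rintro rfl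
  exact h hn

theorem msubst_subst {σ : ℕ → PreTerm} (hσ : IsTermSubst σ) (i : ℕ) (u : PreTerm)
    (φ : PreFormula) :
    (φ.subst (2 * i) u).msubst σ = (φ.msubst σ).subst (2 * i) (u.msubst σ) := by
  induction φ with
  | atom R s t => simp [subst, msubst, PreTerm.msubst_subst hσ]
  | natom R s t => simp [subst, msubst, PreTerm.msubst_subst hσ]
  | and φ ψ ihφ ihψ => simp [subst, msubst, ihφ, ihψ]
  | or φ ψ ihφ ihψ => simp [subst, msubst, ihφ, ihψ]
  | all j φ ih | ex j φ ih =>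
    by_cases h : i = j
    · simp [subst, msubst, h]
    · simp [subst, msubst, h, ih]

/-- Instantiating a quantifier by a variable that does not occur freely, and then replacing that
variable by `t`, amounts to instantiating by `t`. -/
theorem msubst_update_subst {σ : ℕ → PreTerm} (hσ : IsTermSubst σ) {i k : ℕ} {t : PreTerm}
    (ht : t.IsTerm) {φ : PreFormula} (h : 2 * k + 1 ∉ (all i φ).fv) :
    (φ.subst (2 * i) (PreTerm.var (2 * k + 1))).msubst (Function.update σ (2 * k + 1) t) =
      (φ.msubst σ).subst (2 * i) t := by
  have hk : 2 * k + 1 ∉ φ.fv := fun hk => h (Finset.mem_erase.2 ⟨by omega, hk⟩)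
  rw [msubst_subst (hσ.update k ht), msubst_update hσ ht hk]
  simp [PreTerm.msubst]

theorem even_mem_fv_msubst {σ : ℕ → PreTerm} (hσ : IsTermSubst σ) {φ : PreFormula} {i : ℕ}
    (h : 2 * i ∈ (φ.msubst σ).fv) : 2 * i ∈ φ.fv := by
  induction φ with
  | atom R s t | natom R s t =>
    simp only [msubst, fv, Finset.mem_union] at h ⊢
    exact h.imp (PreTerm.even_mem_fv_msubst hσ) (PreTerm.even_mem_fv_msubst hσ)
  | and φ ψ ihφ ihψ | or φ ψ ihφ ihψ =>
    simp only [msubst, fv, Finset.mem_union] at h ⊢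
    tauto
  | all j φ ih | ex j φ ih =>
    simp only [msubst, fv, Finset.mem_erase] at h ⊢
    tauto

theorem IsFormula.msubst {φ : PreFormula} (h : φ.IsFormula) {σ : ℕ → PreTerm}
    (hσ : IsTermSubst σ) : (φ.msubst σ).IsFormula :=
  fun i hi => h i (even_mem_fv_msubst hσ hi)

theorem IsSigma.subst {φ : PreFormula} (h : φ.IsSigma) {k : ℕ} {u : PreTerm} (hu : u.IsTerm) :
    (φ.subst k u).IsSigma := by
  induction h with
  | atom R s t => exact .atom R _ _
  | natom R s t => exact .natom R _ _
  | and _ _ ihφ ihψ => exact .and ihφ ihψ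
  | or _ _ ihφ ihψ => exact .or ihφ ihψ
  | @ball φ i t ht hφ ih =>
    by_cases hk : k = 2 * i
    · simpa [PreFormula.ball, PreFormula.subst, hk] using IsSigma.ball i t ht hφ
    · have ht' : 2 * i ∉ (t.subst k u).fv := fun h =>
        (PreTerm.mem_fv_subst h).elim (fun h => ht h.1) (hu i)
      have := IsSigma.ball i _ ht' ih
      simpa [PreFormula.ball, PreFormula.subst, hk, imp, leF, neg, PreTerm.subst, Ne.symm hk]
        using this
  | @bex φ i t ht hφ ih =>
    by_cases hk : k = 2 * i
    · simpa [PreFormula.bex, PreFormula.subst, hk] using IsSigma.bex i t ht hφ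
    · have ht' : 2 * i ∉ (t.subst k u).fv := fun h =>
        (PreTerm.mem_fv_subst h).elim (fun h => ht h.1) (hu i)
      have := IsSigma.bex i _ ht' ih
      simpa [PreFormula.bex, PreFormula.subst, hk, leF, PreTerm.subst, Ne.symm hk] using this
  | @ex φ i hφ ih =>
    by_cases hk : k = 2 * i
    · simpa [PreFormula.subst, hk] using IsSigma.ex i hφ
    · simpa [PreFormula.subst, hk] using IsSigma.ex i ih

theorem IsDeltaZero.isSigma {φ : PreFormula} (h : φ.IsDeltaZero) : φ.IsSigma := by
  induction h with
  | atom R s t => exact .atom R s t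
  | natom R s t => exact .natom R s t
  | and _ _ ihφ ihψ => exact .and ihφ ihψ
  | or _ _ ihφ ihψ => exact .or ihφ ihψ
  | ball i t ht _ ih => exact .ball i t ht ih
  | bex i t ht _ ih => exact .bex i t ht ih

theorem IsSigmaOne.isSigma {φ : PreFormula} (h : φ.IsSigmaOne) : φ.IsSigma := by
  obtain ⟨i, θ, hθ, rfl⟩ := h
  exact .ex i hθ.isSigma

/-- The number of nested connectives and quantifiers. -/
def depth : PreFormula → ℕ
  | atom _ _ _ => 0
  | natom _ _ _ => 0
  | and φ ψ => max φ.depth ψ.depth + 1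
  | or φ ψ => max φ.depth ψ.depth + 1
  | all _ φ => φ.depth + 1
  | ex _ φ => φ.depth + 1

@[simp] theorem depth_subst (φ : PreFormula) (k : ℕ) (u : PreTerm) :
    (φ.subst k u).depth = φ.depth := by
  induction φ with
  | atom R s t => rfl
  | natom R s t => rfl
  | and φ ψ ihφ ihψ => simp [subst, depth, ihφ, ihψ]
  | or φ ψ ihφ ihψ => simp [subst, depth, ihφ, ihψ]
  | all i φ ih => by_cases h : k = 2 * i <;> simp [subst, depth, ih, h]
  | ex i φ ih => by_cases h : k = 2 * i <;> simp [subst, depth, ih, h]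

theorem depth_neg (φ : PreFormula) : φ.neg.depth = φ.depth := by
  induction φ <;> simp_all [neg, depth]

@[simp] theorem depth_msubst (φ : PreFormula) (σ : ℕ → PreTerm) :
    (φ.msubst σ).depth = φ.depth := by
  induction φ <;> simp_all [msubst, depth]

end PreFormula

open PreFormula

/-! ### A sequent calculus without eigenvariables -/

/-- The cut formulas allowed at level `r`: those that are `Σ` up to negation, and those of depth
less than `r`. -/
def IsCutFormula (r : ℕ) (φ : PreFormula) : Prop :=
  φ.IsSigma ∨ φ.neg.IsSigma ∨ φ.depth < r

theorem IsCutFormula.mono {r s : ℕ} (hrs : r ≤ s) {φ : PreFormula} (h : IsCutFormula r φ) :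
    IsCutFormula s φ :=
  h.imp_right (Or.imp_right fun h => h.trans_le hrs)

/-- An auxiliary calculus with the induction rule, in which the cut formulas are those allowed at
level `r`. In place of an eigenvariable, the rule for `∀` and the induction rule have one premise
for every term. This makes all structural properties provable by plain inductions over derivations,
without renaming of variables; for the same purpose, principal formulas are required to be members
of the conclusion and are kept in the premises. Nothing forces the elements of `Γ` to be formulas
rather than pre-formulas. -/
inductive Deriv (r : ℕ) : Finset PreFormula → Prop
  | ax {Γ : Finset PreFormula} (R : RelSym) (s t : PreTerm) :
      atom R s t ∈ Γ → natom R s t ∈ Γ → Deriv r Γ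
  | and {Γ : Finset PreFormula} {φ ψ : PreFormula} :
      PreFormula.and φ ψ ∈ Γ → Deriv r (insert φ Γ) → Deriv r (insert ψ Γ) → Deriv r Γ
  | or {Γ : Finset PreFormula} {φ ψ : PreFormula} :
      PreFormula.or φ ψ ∈ Γ → Deriv r (insert φ (insert ψ Γ)) → Deriv r Γ
  | all {Γ : Finset PreFormula} {i : ℕ} {φ : PreFormula} :
      PreFormula.all i φ ∈ Γ →
      (∀ t : PreTerm, t.IsTerm → Deriv r (insert (φ.subst (2 * i) t) Γ)) → Deriv r Γ
  | ex {Γ : Finset PreFormula} {i : ℕ} {φ : PreFormula} (t : PreTerm) :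
      PreFormula.ex i φ ∈ Γ → t.IsTerm → Deriv r (insert (φ.subst (2 * i) t) Γ) → Deriv r Γ
  | cut {Γ : Finset PreFormula} (φ : PreFormula) :
      φ.IsFormula → IsCutFormula r φ → Deriv r (insert φ Γ) → Deriv r (insert φ.neg Γ) →
      Deriv r Γ
  | ir {Γ : Finset PreFormula} (φ : PreFormula) (i : ℕ) (t : PreTerm) :
      φ.IsSigma → (PreFormula.all i φ).IsFormula → t.IsTerm →
      (φ.subst (2 * i) PreTerm.zero).neg ∈ Γ → φ.subst (2 * i) t ∈ Γ →
      (∀ s : PreTerm, s.IsTerm →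
        Deriv r (insert (φ.subst (2 * i) s).neg (insert (φ.subst (2 * i) s.succ) Γ))) →
      Deriv r Γ

namespace Deriv

variable {r s : ℕ} {Γ Δ : Finset PreFormula}

theorem mono (hrs : r ≤ s) (h : Deriv r Γ) : Deriv s Γ := by
  induction h with
  | ax R s t h₁ h₂ => exact .ax R s t h₁ h₂
  | and h _ _ ih₁ ih₂ => exact .and h ih₁ ih₂
  | or h _ ih => exact .or h ih
  | all h _ ih => exact .all h ih
  | ex t h ht _ ih => exact .ex t h ht ih
  | cut φ hφ hr _ _ ih₁ ih₂ => exact .cut φ hφ (hr.mono hrs) ih₁ ih₂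
  | ir φ i t hσ hφ ht h₁ h₂ _ ih => exact .ir φ i t hσ hφ ht h₁ h₂ ih

theorem weaken (h : Deriv r Γ) (hΓ : Γ ⊆ Δ) : Deriv r Δ := by
  induction h generalizing Δ with
  | ax R s t h₁ h₂ => exact .ax R s t (hΓ h₁) (hΓ h₂)
  | and h _ _ ih₁ ih₂ =>
    exact .and (hΓ h) (ih₁ (Finset.insert_subset_insert _ hΓ))
      (ih₂ (Finset.insert_subset_insert _ hΓ))
  | or h _ ih =>
    exact .or (hΓ h) (ih (Finset.insert_subset_insert _ (Finset.insert_subset_insert _ hΓ)))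
  | all h _ ih => exact .all (hΓ h) fun t ht => ih t ht (Finset.insert_subset_insert _ hΓ)
  | ex t h ht _ ih => exact .ex t (hΓ h) ht (ih (Finset.insert_subset_insert _ hΓ))
  | cut φ hφ hr _ _ ih₁ ih₂ =>
    exact .cut φ hφ hr (ih₁ (Finset.insert_subset_insert _ hΓ))
      (ih₂ (Finset.insert_subset_insert _ hΓ))
  | ir φ i t hσ hφ ht h₁ h₂ _ ih =>
    exact .ir φ i t hσ hφ ht (hΓ h₁) (hΓ h₂) fun s hs =>
      ih s hs (Finset.insert_subset_insert _ (Finset.insert_subset_insert _ hΓ))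

theorem of_mem_of_neg_mem {φ : PreFormula} (h : φ ∈ Γ) (h' : φ.neg ∈ Γ) : Deriv r Γ := by
  induction hn : φ.depth using Nat.strong_induction_on generalizing φ Γ with
  | _ n ih =>
    subst hn
    cases φ with
    | atom R s t => exact .ax R s t h h'
    | natom R s t => exact .ax R s t h' h
    | and φ ψ =>
      refine .or h' (.and (φ := φ) (ψ := ψ) (by simp [h]) ?_ ?_)
      · exact ih φ.depth (by simp [depth]) (by simp) (by simp) rfl
      · exact ih ψ.depth (by simp [depth]) (by simp) (by simp) rfl
    | or φ ψ =>
      refine .or h (.and (φ := φ.neg) (ψ := ψ.neg) ?_ ?_ ?_)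
      · simp only [neg] at h'
        simp [h']
      · exact ih φ.depth (by simp [depth]) (by simp) (by simp) rfl
      · exact ih ψ.depth (by simp [depth]) (by simp) (by simp) rfl
    | all i φ =>
      refine .all h fun t ht => .ex (i := i) (φ := φ.neg) t ?_ ht ?_
      · simp only [neg] at h'
        simp [h']
      · exact ih (φ.subst (2 * i) t).depth (by simp [depth]) (by simp)
          (by simp [neg_subst]) rfl
    | ex i φ =>
      refine .all h' fun t ht => .ex (i := i) (φ := φ) t (by simp [h]) ht ?_
      exact ih (φ.subst (2 * i) t).depth (by simp [depth]) (by simp) (by simp [neg_subst]) rfl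

end Deriv

/-! ### Partial cut elimination -/

namespace Deriv

variable {r : ℕ} {Γ Δ K : Finset PreFormula}

/-- A formula `χ` that is not `Σ` up to negation is principal in no axiom and in no application of
the induction rule. Hence it can be removed from a derivation as soon as, in any context `Γ'` that
contains `K`, it can be removed from the conclusion of the logical rule that introduces it. -/
theorem remove {χ : PreFormula} (hχ : ¬χ.IsSigma) (hχ' : ¬χ.neg.IsSigma)
    (hand : ∀ φ ψ Γ', χ = PreFormula.and φ ψ → K ⊆ Γ' →
      Deriv r (insert φ Γ') → Deriv r (insert ψ Γ') → Deriv r Γ')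
    (hor : ∀ φ ψ Γ', χ = PreFormula.or φ ψ → K ⊆ Γ' →
      Deriv r (insert φ (insert ψ Γ')) → Deriv r Γ')
    (hall : ∀ i φ Γ', χ = PreFormula.all i φ → K ⊆ Γ' →
      (∀ t : PreTerm, t.IsTerm → Deriv r (insert (φ.subst (2 * i) t) Γ')) → Deriv r Γ')
    (hex : ∀ i φ t Γ', χ = PreFormula.ex i φ → K ⊆ Γ' → t.IsTerm →
      Deriv r (insert (φ.subst (2 * i) t) Γ') → Deriv r Γ')
    (h : Deriv r Δ) (hK : K ⊆ Γ) (hΔ : Δ ⊆ insert χ Γ) : Deriv r Γ := by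
  have step : ∀ {Δ Γ : Finset PreFormula} (φ : PreFormula), Δ ⊆ insert χ Γ →
      insert φ Δ ⊆ insert χ (insert φ Γ) := fun φ h => by
    rw [Finset.insert_comm]
    exact Finset.insert_subset_insert _ h
  have hins : ∀ {Γ : Finset PreFormula} (φ : PreFormula), K ⊆ Γ → K ⊆ insert φ Γ :=
    fun φ h => h.trans (Finset.subset_insert _ _)
  have side : ∀ {Δ Γ : Finset PreFormula} {φ : PreFormula}, Δ ⊆ insert χ Γ → φ ∈ Δ →
      χ = φ ∨ φ ∈ Γ := fun h hφ => (Finset.mem_insert.1 (h hφ)).imp_left Eq.symm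
  induction h generalizing Γ with
  | ax R s t h₁ h₂ =>
    have h₁' := (side hΔ h₁).resolve_left fun h => hχ (h ▸ .atom R s t)
    have h₂' := (side hΔ h₂).resolve_left fun h => hχ (h ▸ .natom R s t)
    exact .ax R s t h₁' h₂'
  | @and _ φ ψ h _ _ ih₁ ih₂ =>
    have h₁ := ih₁ (hins φ hK) (step φ hΔ)
    have h₂ := ih₂ (hins ψ hK) (step ψ hΔ)
    exact (side hΔ h).elim (fun h => hand φ ψ Γ h hK h₁ h₂) fun h => .and h h₁ h₂
  | @or _ φ ψ h _ ih =>
    have h₁ := ih (hins φ (hins ψ hK)) (step φ (step ψ hΔ))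
    exact (side hΔ h).elim (fun h => hor φ ψ Γ h hK h₁) fun h => .or h h₁
  | @all _ i φ h _ ih =>
    have h₁ := fun t ht => ih t ht (hins _ hK) (step _ hΔ)
    exact (side hΔ h).elim (fun h => hall i φ Γ h hK h₁) fun h => .all h h₁
  | @ex _ i φ t h ht _ ih =>
    have h₁ := ih (hins _ hK) (step _ hΔ)
    exact (side hΔ h).elim (fun h => hex i φ t Γ h hK ht h₁) fun h => .ex t h ht h₁
  | cut φ hφ hr _ _ ih₁ ih₂ =>
    exact .cut φ hφ hr (ih₁ (hins _ hK) (step _ hΔ)) (ih₂ (hins _ hK) (step _ hΔ))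
  | ir φ i t hσ hφ ht h₁ h₂ _ ih =>
    have h₁' := (side hΔ h₁).resolve_left fun h =>
      hχ' (by rw [h, neg_neg]; exact hσ.subst PreTerm.isTerm_zero)
    have h₂' := (side hΔ h₂).resolve_left fun h => hχ (h ▸ hσ.subst ht)
    exact .ir φ i t hσ hφ ht h₁' h₂' fun s hs =>
      ih s hs (hins _ (hins _ hK)) (step _ (step _ hΔ))

theorem and_inversion_left {φ ψ : PreFormula} (hχ : ¬(PreFormula.and φ ψ).IsSigma)
    (hχ' : ¬(PreFormula.and φ ψ).neg.IsSigma) (h : Deriv r (insert (PreFormula.and φ ψ) Γ)) :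
    Deriv r (insert φ Γ) := by
  refine remove (K := {φ}) hχ hχ' ?_ ?_ ?_ ?_ h (by simp)
    (Finset.insert_subset_insert _ (Finset.subset_insert _ _))
  · rintro φ' ψ' Γ' heq hK h₁ -
    cases heq
    rwa [Finset.insert_eq_of_mem (by simpa using hK)] at h₁
  all_goals simp

theorem and_inversion_right {φ ψ : PreFormula} (hχ : ¬(PreFormula.and φ ψ).IsSigma)
    (hχ' : ¬(PreFormula.and φ ψ).neg.IsSigma) (h : Deriv r (insert (PreFormula.and φ ψ) Γ)) :
    Deriv r (insert ψ Γ) := by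
  refine remove (K := {ψ}) hχ hχ' ?_ ?_ ?_ ?_ h (by simp)
    (Finset.insert_subset_insert _ (Finset.subset_insert _ _))
  · rintro φ' ψ' Γ' heq hK - h₂
    cases heq
    rwa [Finset.insert_eq_of_mem (by simpa using hK)] at h₂
  all_goals simp

theorem or_inversion {φ ψ : PreFormula} (hχ : ¬(PreFormula.or φ ψ).IsSigma)
    (hχ' : ¬(PreFormula.or φ ψ).neg.IsSigma) (h : Deriv r (insert (PreFormula.or φ ψ) Γ)) :
    Deriv r (insert φ (insert ψ Γ)) := by
  refine remove (K := {φ, ψ}) hχ hχ' ?_ ?_ ?_ ?_ h (by simp [Finset.insert_subset_iff])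
    (Finset.insert_subset_insert _
      ((Finset.subset_insert _ _).trans (Finset.subset_insert _ _)))
  · simp
  · rintro φ' ψ' Γ' heq hK h₁
    cases heq
    rw [Finset.insert_subset_iff, Finset.singleton_subset_iff] at hK
    rwa [Finset.insert_eq_of_mem hK.2, Finset.insert_eq_of_mem hK.1] at h₁
  all_goals simp

theorem all_inversion {i : ℕ} {φ : PreFormula} (hχ : ¬(PreFormula.all i φ).IsSigma)
    (hχ' : ¬(PreFormula.all i φ).neg.IsSigma) (h : Deriv r (insert (PreFormula.all i φ) Γ))
    {t : PreTerm} (ht : t.IsTerm) : Deriv r (insert (φ.subst (2 * i) t) Γ) := by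
  refine remove (K := {φ.subst (2 * i) t}) hχ hχ' ?_ ?_ ?_ ?_ h (by simp)
    (Finset.insert_subset_insert _ (Finset.subset_insert _ _))
  · simp
  · simp
  · rintro i' φ' Γ' heq hK h₁
    cases heq
    have := h₁ t ht
    rwa [Finset.insert_eq_of_mem (by simpa using hK)] at this
  · simp

/-- A cut on `φ ∧ ψ` is replaced by cuts on `φ` and `ψ`. -/
theorem cut_and {φ ψ : PreFormula} (hF : (PreFormula.and φ ψ).IsFormula)
    (hd : (PreFormula.and φ ψ).depth ≤ r) (hχ : ¬(PreFormula.and φ ψ).IsSigma)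
    (hχ' : ¬(PreFormula.and φ ψ).neg.IsSigma) (h₁ : Deriv r (insert (PreFormula.and φ ψ) Γ))
    (h₂ : Deriv r (insert (PreFormula.and φ ψ).neg Γ)) : Deriv r Γ := by
  simp only [depth] at hd
  have h₃ := or_inversion (φ := φ.neg) (ψ := ψ.neg) hχ' (by simpa [neg] using hχ) h₂
  refine .cut φ (fun i hi => hF i (Finset.mem_union_left _ hi)) (.inr (.inr (by omega)))
    (and_inversion_left hχ hχ' h₁) ?_
  refine .cut ψ (fun i hi => hF i (Finset.mem_union_right _ hi)) (.inr (.inr (by omega)))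
    ((and_inversion_right hχ hχ' h₁).weaken
      (Finset.insert_subset_insert _ (Finset.subset_insert _ _))) ?_
  rwa [Finset.insert_comm]

/-- A cut on `∀ x φ` is replaced by cuts on instances of `φ`, at the places where the negation
`∃ x ¬φ` is introduced. -/
theorem cut_all {i : ℕ} {φ : PreFormula} (hF : (PreFormula.all i φ).IsFormula)
    (hd : (PreFormula.all i φ).depth ≤ r) (hχ : ¬(PreFormula.all i φ).IsSigma)
    (hχ' : ¬(PreFormula.all i φ).neg.IsSigma) (h₁ : Deriv r (insert (PreFormula.all i φ) Γ))
    (h₂ : Deriv r (insert (PreFormula.all i φ).neg Γ)) : Deriv r Γ := by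
  refine remove (K := Γ) hχ' (by simpa using hχ) ?_ ?_ ?_ ?_ h₂ subset_rfl subset_rfl
  · simp [neg]
  · simp [neg]
  · simp [neg]
  · rintro i' φ' t Γ' heq hK ht h₃
    cases heq
    refine .cut (φ.subst (2 * i) t) (isFormula_subst hF ht)
      (.inr (.inr ?_)) ?_ (by rwa [neg_subst])
    · rw [depth_subst]
      exact hd
    · exact (all_inversion hχ hχ' h₁ ht).weaken (Finset.insert_subset_insert _ hK)

/-- A cut of depth `r` on a formula that is not `Σ` up to negation can be replaced by cuts of
smaller depth. -/
theorem cut_reduction {φ : PreFormula} (hF : φ.IsFormula) (hd : φ.depth ≤ r) (hχ : ¬φ.IsSigma)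
    (hχ' : ¬φ.neg.IsSigma) (h₁ : Deriv r (insert φ Γ)) (h₂ : Deriv r (insert φ.neg Γ)) :
    Deriv r Γ := by
  cases φ with
  | atom R s t => exact absurd (.atom R s t) hχ
  | natom R s t => exact absurd (.natom R s t) hχ
  | and φ ψ => exact cut_and hF hd hχ hχ' h₁ h₂
  | or φ ψ =>
    exact cut_and (φ := φ.neg) (ψ := ψ.neg) (isFormula_neg.2 hF) ((depth_neg _).trans_le hd) hχ'
      (by simpa [neg] using hχ) h₂ (by simpa [neg] using h₁)
  | all i φ => exact cut_all hF hd hχ hχ' h₁ h₂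
  | ex i φ =>
    exact cut_all (φ := φ.neg) (isFormula_neg.2 hF) ((depth_neg _).trans_le hd) hχ'
      (by simpa [neg] using hχ) h₂ (by simpa [neg] using h₁)

theorem cut_elimination_step (h : Deriv (r + 1) Γ) : Deriv r Γ := by
  induction h with
  | ax R s t h₁ h₂ => exact .ax R s t h₁ h₂
  | and h _ _ ih₁ ih₂ => exact .and h ih₁ ih₂
  | or h _ ih => exact .or h ih
  | all h _ ih => exact .all h ih
  | ex t h ht _ ih => exact .ex t h ht ih
  | cut φ hφ hr _ _ ih₁ ih₂ =>
    by_cases hσ : φ.IsSigma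
    · exact .cut φ hφ (.inl hσ) ih₁ ih₂
    by_cases hπ : φ.neg.IsSigma
    · exact .cut φ hφ (.inr (.inl hπ)) ih₁ ih₂
    exact cut_reduction hφ (Nat.lt_succ_iff.1 ((hr.resolve_left hσ).resolve_left hπ)) hσ hπ
      ih₁ ih₂
  | ir φ i t hσ hφ ht h₁ h₂ _ ih => exact .ir φ i t hσ hφ ht h₁ h₂ ih

/-- Partial cut elimination: all cuts can be removed except those on formulas that are `Σ` up to
negation. -/
theorem cut_elimination (h : Deriv r Γ) : Deriv 0 Γ := by
  induction r with
  | zero => exact h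
  | succ r ih => exact ih h.cut_elimination_step

end Deriv

/-! ### Translations between the calculi -/

theorem Derivable.isSequent {Γ : Finset PreFormula} (h : Derivable Γ) : IsSequent Γ := by
  induction h with
  | ax φ h _ _ _ => exact h
  | and _ _ ih₁ ih₂ =>
    simp only [IsSequent, Finset.forall_mem_insert] at ih₁ ih₂ ⊢
    refine ⟨fun i hi => ?_, ih₁.2⟩
    exact (Finset.mem_union.1 hi).elim (ih₁.1 i) (ih₂.1 i)
  | orLeft h _ ih =>
    simp only [IsSequent, Finset.forall_mem_insert] at ih ⊢
    exact ⟨fun i hi => (Finset.mem_union.1 hi).elim (ih.1 i) (h i), ih.2⟩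
  | orRight h _ ih =>
    simp only [IsSequent, Finset.forall_mem_insert] at ih ⊢
    exact ⟨fun i hi => (Finset.mem_union.1 hi).elim (h i) (ih.1 i), ih.2⟩
  | all k h _ _ _ _ => exact h
  | ex t h _ _ _ => exact h
  | cut φ _ _ _ ih _ => exact fun ψ hψ => ih ψ (Finset.mem_insert_of_mem hψ)

/-- Since finitely many cuts occur in a derivation, their depth is bounded. The substitution `σ`
provides, for the rule for `∀`, the premises for all terms instead of an eigenvariable. -/
theorem Derivable.exists_deriv {Γ : Finset PreFormula} (h : Derivable Γ) :
    ∃ r, ∀ σ, IsTermSubst σ → Deriv r (Γ.image (msubst σ)) := by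
  induction h with
  | @ax Γ φ _ _ h₁ h₂ =>
    refine ⟨0, fun σ hσ => Deriv.of_mem_of_neg_mem (φ := φ.msubst σ) ?_ ?_⟩
    · exact Finset.mem_image_of_mem _ h₁
    · rw [← msubst_neg]
      exact Finset.mem_image_of_mem _ h₂
  | @and Γ φ ψ _ _ ih₁ ih₂ =>
    obtain ⟨r₁, h₁⟩ := ih₁
    obtain ⟨r₂, h₂⟩ := ih₂
    refine ⟨max r₁ r₂, fun σ hσ => ?_⟩
    have h₁ := (h₁ σ hσ).mono (le_max_left r₁ r₂)
    have h₂ := (h₂ σ hσ).mono (le_max_right r₁ r₂)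
    rw [Finset.image_insert] at h₁ h₂ ⊢
    exact .and (Finset.mem_insert_self _ _)
      (h₁.weaken (Finset.insert_subset_insert _ (Finset.subset_insert _ _)))
      (h₂.weaken (Finset.insert_subset_insert _ (Finset.subset_insert _ _)))
  | @orLeft Γ φ ψ _ _ ih =>
    obtain ⟨r, h⟩ := ih
    refine ⟨r, fun σ hσ => ?_⟩
    have h := h σ hσ
    rw [Finset.image_insert] at h ⊢
    exact .or (Finset.mem_insert_self _ _) (h.weaken (Finset.insert_subset_insert _
      ((Finset.subset_insert _ _).trans (Finset.subset_insert _ _))))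
  | @orRight Γ φ ψ _ _ ih =>
    obtain ⟨r, h⟩ := ih
    refine ⟨r, fun σ hσ => ?_⟩
    have h := h σ hσ
    rw [Finset.image_insert] at h ⊢
    exact .or (Finset.mem_insert_self _ _) (h.weaken ((Finset.insert_subset_insert _
      (Finset.subset_insert _ _)).trans (Finset.subset_insert _ _)))
  | @all Γ Γ₀ φ i k _ hΓ hk _ ih =>
    obtain ⟨r, h⟩ := ih
    refine ⟨r, fun σ hσ => ?_⟩
    simp only [seqFV, Finset.mem_biUnion, Finset.mem_insert, not_exists, not_and, forall_eq_or_imp]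
      at hk
    rw [Finset.image_insert]
    refine .all (Finset.mem_insert_self _ _) fun t ht => ?_
    have h := h _ (hσ.update k ht)
    rw [Finset.image_insert, msubst_update_subst hσ ht hk.1] at h
    refine h.weaken (Finset.insert_subset_insert _ fun ψ hψ => ?_)
    obtain ⟨χ, hχ, rfl⟩ := Finset.mem_image.1 hψ
    rw [msubst_update hσ ht (hk.2 χ hχ)]
    exact Finset.mem_insert_of_mem (Finset.mem_image_of_mem _ (hΓ hχ))
  | @ex Γ φ i t _ ht _ ih =>
    obtain ⟨r, h⟩ := ih
    refine ⟨r, fun σ hσ => ?_⟩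
    have h := h σ hσ
    rw [Finset.image_insert, msubst_subst hσ] at h
    rw [Finset.image_insert]
    exact .ex (t.msubst σ) (Finset.mem_insert_self _ _) (ht.msubst hσ)
      (h.weaken (Finset.insert_subset_insert _ (Finset.subset_insert _ _)))
  | @cut Γ φ hφ _ _ ih₁ ih₂ =>
    obtain ⟨r₁, h₁⟩ := ih₁
    obtain ⟨r₂, h₂⟩ := ih₂
    refine ⟨max (max r₁ r₂) (φ.depth + 1), fun σ hσ => ?_⟩
    have h₁ := (h₁ σ hσ).mono ((le_max_left r₁ r₂).trans (le_max_left _ (φ.depth + 1)))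
    have h₂ := (h₂ σ hσ).mono ((le_max_right r₁ r₂).trans (le_max_left _ (φ.depth + 1)))
    rw [Finset.image_insert] at h₁ h₂
    rw [msubst_neg] at h₂
    refine .cut (φ.msubst σ) (hφ.msubst hσ) (.inr (.inr ?_)) h₁ h₂
    rw [depth_msubst]
    exact lt_max_of_lt_right (Nat.lt_succ_self _)

theorem exists_fresh (Γ : Finset PreFormula) : ∃ k, 2 * k + 1 ∉ seqFV Γ := by
  obtain ⟨k, hk⟩ := (seqFV Γ).exists_nat_subset_range
  exact ⟨k, fun h => by have := Finset.mem_range.1 (hk h); omega⟩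

theorem Deriv.derivableIR {Γ : Finset PreFormula} (h : Deriv 0 Γ) (hΓ : IsSequent Γ) :
    DerivableIR Γ := by
  have hins : ∀ {φ : PreFormula} {Γ : Finset PreFormula}, φ.IsFormula → IsSequent Γ →
      IsSequent (insert φ Γ) := fun h₁ h₂ => Finset.forall_mem_insert _ _ _ |>.2 ⟨h₁, h₂⟩
  induction h with
  | ax R s t h₁ h₂ => exact .ax (atom R s t) hΓ (hΓ _ h₁) h₁ h₂
  | and h _ _ ih₁ ih₂ =>
    have h₁ := ih₁ (hins (fun i hi => hΓ _ h i (Finset.mem_union_left _ hi)) hΓ)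
    have h₂ := ih₂ (hins (fun i hi => hΓ _ h i (Finset.mem_union_right _ hi)) hΓ)
    have := DerivableIR.and h₁ h₂
    rwa [Finset.insert_eq_of_mem h] at this
  | @or _ φ ψ h _ ih =>
    have hφ : φ.IsFormula := fun i hi => hΓ _ h i (Finset.mem_union_left _ hi)
    have hψ : ψ.IsFormula := fun i hi => hΓ _ h i (Finset.mem_union_right _ hi)
    have h₁ := DerivableIR.orLeft hψ (ih (hins hφ (hins hψ hΓ)))
    rw [Finset.insert_comm] at h₁
    have := DerivableIR.orRight hφ h₁
    rwa [Finset.insert_idem, Finset.insert_eq_of_mem h] at this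
  | @all Γ i φ h _ ih =>
    obtain ⟨k, hk⟩ := exists_fresh (insert (PreFormula.all i φ) Γ)
    have ht := PreTerm.isTerm_var k
    have := DerivableIR.all k (hins (hΓ _ h) hΓ) subset_rfl hk
      (ih _ ht (hins (isFormula_subst (hΓ _ h) ht) hΓ))
    rwa [Finset.insert_eq_of_mem h] at this
  | @ex Γ i φ t h ht _ ih =>
    have := DerivableIR.ex t (hins (hΓ _ h) hΓ) ht
      (ih (hins (isFormula_subst (i := i) (hΓ (PreFormula.ex i φ) h) ht) hΓ))
    rwa [Finset.insert_eq_of_mem h] at this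
  | cut φ hφ hr _ _ ih₁ ih₂ =>
    have h₁ := ih₁ (hins hφ hΓ)
    have h₂ := ih₂ (hins (isFormula_neg.2 hφ) hΓ)
    rcases hr with hr | hr | hr
    · exact .sigmaCut φ hφ hr h₁ h₂
    · exact .sigmaCut φ.neg (isFormula_neg.2 hφ) hr h₂ (by rwa [PreFormula.neg_neg])
    · exact absurd hr (Nat.not_lt_zero _)
  | @ir Γ φ i t hσ hφ ht h₁ h₂ _ ih =>
    obtain ⟨k, hk⟩ := exists_fresh (insert (PreFormula.all i φ) Γ)
    have hk' := PreTerm.isTerm_var k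
    have := DerivableIR.ir φ i k t hσ hφ ht hΓ subset_rfl hk
      (ih _ hk' (hins (isFormula_neg.2 (isFormula_subst hφ hk'))
        (hins (isFormula_subst hφ hk'.succ) hΓ)))
    rwa [Finset.insert_eq_of_mem h₂, Finset.insert_eq_of_mem h₁] at this

/-! ### Deriving the axioms -/

/-- `A ↔ ∃ x B` follows from `(A → ∃ x (L ∧ B)) ∧ (∃ x B → A)`. This applies to the axioms in which
an unbounded existential quantifier is replaced by a bounded one. -/
theorem deriv_iff_ex {r : ℕ} {Γ : Finset PreFormula} {i : ℕ} {A L B : PreFormula}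
    (h : iff A (ex i B) ∈ Γ)
    (h' : (and (imp A (ex i (and L B))) (imp (ex i B) A)).neg ∈ Γ) : Deriv r Γ := by
  simp only [neg, imp, neg_neg] at h'
  refine .and (φ := imp A (ex i B)) (ψ := imp (ex i B) A) h ?_ ?_
  · refine .or (φ := A.neg) (ψ := ex i B) (Finset.mem_insert_self _ _) ?_
    refine .or (φ := A.and (all i (L.neg.or B.neg))) (ψ := (ex i B).and A.neg) (by simp [h']) ?_
    refine .and (φ := A) (ψ := all i (L.neg.or B.neg)) (by simp) ?_ ?_
    · exact Deriv.of_mem_of_neg_mem (φ := A) (by simp) (by simp)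
    · refine .all (i := i) (φ := L.neg.or B.neg) (by simp) fun t ht => ?_
      refine .or (φ := L.neg.subst (2 * i) t) (ψ := B.neg.subst (2 * i) t)
        (Finset.mem_insert_self _ _) ?_
      refine .ex (i := i) (φ := B) t (by simp) ht ?_
      exact Deriv.of_mem_of_neg_mem (φ := B.subst (2 * i) t) (by simp) (by simp [neg_subst])
  · refine .or (φ := (ex i B).neg) (ψ := A) (Finset.mem_insert_self _ _) ?_
    refine .or (φ := A.and (all i (L.neg.or B.neg))) (ψ := (ex i B).and A.neg) (by simp [h']) ?_
    refine .and (φ := ex i B) (ψ := A.neg) (by simp) ?_ ?_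
    · exact Deriv.of_mem_of_neg_mem (φ := ex i B) (by simp) (by simp)
    · exact Deriv.of_mem_of_neg_mem (φ := A) (by simp) (by simp)

theorem deriv_indMatrix {r : ℕ} {Γ : Finset PreFormula} {j : ℕ} {φ : PreFormula} (hφ : φ.IsSigma)
    (hF : (all j φ).IsFormula) (h : indMatrix j φ ∈ Γ) : Deriv r Γ := by
  simp only [indMatrix, imp, neg, neg_neg] at h
  refine .or h ?_
  refine .or (φ := (φ.subst (2 * j) PreTerm.zero).neg) (Finset.mem_insert_self _ _) ?_
  refine .all (i := j) (φ := φ) (by simp) fun t ht => ?_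
  refine .ir φ j t hφ hF ht (by simp) (by simp) fun s hs => ?_
  refine .ex s (i := j)
    (φ := φ.and (φ.subst (2 * j) (PreTerm.succ (PreTerm.var (2 * j)))).neg) (by simp) hs ?_
  simp only [subst, ← neg_subst, subst_subst_same, PreTerm.subst, if_true]
  refine .and (Finset.mem_insert_self _ _) ?_ ?_
  · exact Deriv.of_mem_of_neg_mem (φ := φ.subst (2 * j) s) (by simp) (by simp)
  · exact Deriv.of_mem_of_neg_mem (φ := φ.subst (2 * j) s.succ) (by simp) (by simp)

theorem alls_subst {i : ℕ} {L : List ℕ} (hi : i ∉ L) (φ : PreFormula) (t : PreTerm) :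
    (alls L φ).subst (2 * i) t = alls L (φ.subst (2 * i) t) := by
  induction L with
  | nil => rfl
  | cons j L ih =>
    simp only [List.mem_cons, not_or] at hi
    have : 2 * i ≠ 2 * j := by omega
    simpa [alls, subst, this] using ih hi.2

theorem indMatrix_subst {i j : ℕ} (hij : i ≠ j) (φ : PreFormula) {t : PreTerm} (ht : t.IsTerm) :
    (indMatrix j φ).subst (2 * i) t = indMatrix j (φ.subst (2 * i) t) := by
  have h : 2 * j ≠ 2 * i := by omega
  simp only [indMatrix, imp, neg, neg_neg, subst, h.symm, if_false, ← neg_subst]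
  rw [subst_comm h (by simp [PreTerm.fv]) (ht j),
    subst_comm h (by simpa [PreTerm.fv] using h.symm) (ht j)]

theorem deriv_alls_indMatrix {r : ℕ} {Γ : Finset PreFormula} {j : ℕ} {L : List ℕ} (hL : L.Nodup)
    (hj : j ∉ L) {φ : PreFormula} (hφ : φ.IsSigma) (hF : ∀ i, 2 * i ∈ (all j φ).fv → i ∈ L)
    (h : alls L (indMatrix j φ) ∈ Γ) : Deriv r Γ := by
  induction L generalizing φ Γ with
  | nil => exact deriv_indMatrix hφ (fun i hi => by simpa using hF i hi) h
  | cons i L ih =>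
    rw [List.nodup_cons] at hL
    simp only [List.mem_cons, not_or] at hj
    refine .all (i := i) (φ := alls L (indMatrix j φ)) h fun t ht => ?_
    refine ih hL.2 hj.2 (hφ.subst (k := 2 * i) ht) (fun k hk => ?_)
      (by rw [alls_subst hL.1, indMatrix_subst (Ne.symm hj.1) _ ht]; simp)
    obtain ⟨hkj, hk⟩ := Finset.mem_erase.1 hk
    rcases mem_fv_subst hk with ⟨hk, hki⟩ | hk
    · have := hF k (Finset.mem_erase.2 ⟨hkj, hk⟩)
      simp only [List.mem_cons] at this
      exact this.resolve_left (by omega)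
    · exact absurd hk (ht k)

theorem deriv_sigmaOneInduction {θ : PreFormula} (h : θ ∈ sigmaOneInduction) : Deriv 0 {θ} := by
  obtain ⟨φ, j, L, hφ, hL, hfv, rfl⟩ := h
  have hsub : (all j φ).fv ⊆ (indMatrix j φ).fv := Finset.subset_union_right
  refine deriv_alls_indMatrix (j := j) hL (fun hj => ?_) hφ.isSigma (fun i hi => ?_)
    (Finset.mem_singleton_self _)
  · have := (hfv (2 * j)).2 ⟨j, hj, rfl⟩
    simp only [indMatrix, imp, neg, neg_neg, fv, fv_neg, Finset.mem_union, Finset.mem_erase, ne_eq,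
      not_true_eq_false, false_and, or_false] at this
    exact (mem_fv_subst this).elim (fun h => h.2 rfl) (by simp [PreTerm.fv])
  · obtain ⟨k, hk, hik⟩ := (hfv _).1 (hsub hi)
    rwa [show i = k by omega]

/-- The set `A` derives the axiom `θ` in the auxiliary calculus. -/
def DerivesAxiom (A : Set PreFormula) (θ : PreFormula) : Prop :=
  ∃ T : Finset PreFormula, (T : Set PreFormula) ⊆ A ∧ ∃ r, Deriv r (insert θ (T.image neg))

/-- If every axiom of `IΣ₁` is derivable from a set `A` of sentences, then consequences of `IΣ₁` are
derivable from axioms in `A` with cuts over `Σ`-formulas only. -/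
theorem exists_derivableIR {A : Set PreFormula} (hA : ∀ θ ∈ A, θ.IsFormula)
    (hθ : ∀ θ ∈ ISigmaOne, DerivesAxiom A θ) {ψ : PreFormula} (hψ : Proves ISigmaOne ψ) :
    ∃ T : Finset PreFormula, (T : Set PreFormula) ⊆ A ∧
      DerivableIR (insert ψ (T.image neg)) := by
  obtain ⟨S, hS, hder⟩ := hψ
  have hseq := hder.isSequent
  obtain ⟨r, hr⟩ := hder.exists_deriv
  have hd := hr _ isTermSubst_var
  rw [show msubst PreTerm.var = id from funext msubst_var, Finset.image_id] at hd
  -- The axioms in `S` are cut against their derivations from `A`, one after the other.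
  suffices key : ∀ S : Finset PreFormula, (S : Set PreFormula) ⊆ ISigmaOne →
      (∀ θ ∈ S, θ.IsFormula) → ∀ T : Finset PreFormula, (T : Set PreFormula) ⊆ A → ∀ r,
      Deriv r (insert ψ (S.image neg ∪ T.image neg)) →
      ∃ T' : Finset PreFormula, (T' : Set PreFormula) ⊆ A ∧
        ∃ r, Deriv r (insert ψ (T'.image neg)) by
    obtain ⟨T, hT, r, h⟩ := key S hS
      (fun θ h => isFormula_neg.1
        (hseq _ (Finset.mem_insert_of_mem (Finset.mem_image_of_mem _ h))))
      ∅ (by simp) r (by simpa using hd)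
    refine ⟨T, hT, h.cut_elimination.derivableIR ?_⟩
    simp only [IsSequent, Finset.forall_mem_insert, Finset.forall_mem_image]
    exact ⟨hseq ψ (Finset.mem_insert_self _ _), fun θ h => isFormula_neg.2 (hA θ (hT h))⟩
  intro S
  induction S using Finset.induction_on with
  | empty => exact fun _ _ T hT r h => ⟨T, hT, r, by simpa using h⟩
  | insert θ S _ ih =>
    intro hS hF T hT r h
    rw [Finset.coe_insert, Set.insert_subset_iff] at hS
    rw [Finset.forall_mem_insert] at hF
    obtain ⟨T', hT', r', h'⟩ := hθ θ hS.1
    refine ih hS.2 hF.2 (T ∪ T') (by simp [hT, hT']) (max (max r r') (θ.depth + 1)) ?_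
    refine .cut θ hF.1 (.inr (.inr (lt_max_of_lt_right (Nat.lt_succ_self _)))) ?_ ?_
    · refine (h'.mono ((le_max_right r r').trans (le_max_left _ _))).weaken ?_
      refine Finset.insert_subset_insert _ fun χ hχ => ?_
      simp only [Finset.image_union, Finset.mem_insert, Finset.mem_union]
      exact .inr (.inr (.inr hχ))
    · refine (h.mono ((le_max_left r r').trans (le_max_left _ _))).weaken fun χ hχ => ?_
      simp only [Finset.image_insert, Finset.image_union, Finset.mem_insert, Finset.mem_union]
        at hχ ⊢
      tauto

/-- The universal closure of `deriv_iff_ex`. -/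
theorem deriv_alls_iff_ex {r : ℕ} {Γ : Finset PreFormula} {M : List ℕ} (hM : M.Nodup) {i : ℕ}
    (hi : i ∉ M) {A L B : PreFormula} (h : alls M (iff A (ex i B)) ∈ Γ)
    (h' : (alls M (and (imp A (ex i (and L B))) (imp (ex i B) A))).neg ∈ Γ) : Deriv r Γ := by
  induction M generalizing Γ A L B with
  | nil => exact deriv_iff_ex h h'
  | cons j M ih =>
    rw [List.nodup_cons] at hM
    simp only [List.mem_cons, not_or] at hi
    have hij : 2 * j ≠ 2 * i := by omega
    refine .all (i := j) (φ := alls M (iff A (ex i B))) h fun t ht => ?_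
    refine .ex (i := j) (φ := (alls M (and (imp A (ex i (and L B))) (imp (ex i B) A))).neg) t
      (Finset.mem_insert_of_mem h') ht ?_
    refine ih hM.2 hi.2 (A := A.subst (2 * j) t) (L := L.subst (2 * j) t)
      (B := B.subst (2 * j) t) ?_ ?_
    · simp [alls_subst hM.1, PreFormula.iff, imp, subst, neg, hij, ← neg_subst]
    · rw [← neg_subst, alls_subst hM.1]
      simp [imp, subst, neg, hij, ← neg_subst]

theorem isFormula_of_fv_eq_empty {φ : PreFormula} (h : φ.fv = ∅) : φ.IsFormula := by
  intro i
  simp [h]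

theorem isFormula_of_mem_equalityAxioms {θ : PreFormula} (h : θ ∈ equalityAxioms) :
    θ.IsFormula := by
  simp only [equalityAxioms, Set.mem_insert_iff, Set.mem_singleton_iff] at h
  rcases h with rfl | rfl | rfl | rfl | rfl | rfl | rfl | rfl | rfl <;>
    exact isFormula_of_fv_eq_empty rfl

theorem isFormula_of_mem_robinsonCore {θ : PreFormula} (h : θ ∈ robinsonCore) :
    θ.IsFormula := by
  simp only [robinsonCore, Set.mem_insert_iff, Set.mem_singleton_iff] at h
  rcases h with rfl | rfl | rfl | rfl | rfl | rfl <;> exact isFormula_of_fv_eq_empty rfl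

theorem isFormula_of_mem_robinsonQPrime {θ : PreFormula} (h : θ ∈ robinsonQPrime) :
    θ.IsFormula := by
  rcases h with (h | h) | h
  · exact isFormula_of_mem_equalityAxioms h
  · exact isFormula_of_mem_robinsonCore h
  · rw [Set.mem_singleton_iff.1 h]
    exact isFormula_of_fv_eq_empty rfl

theorem derivesAxiom_of_mem {A : Set PreFormula} {θ : PreFormula} (h : θ ∈ A) :
    DerivesAxiom A θ :=
  ⟨{θ}, by simpa, 0, Deriv.of_mem_of_neg_mem (φ := θ) (by simp) (by simp)⟩

theorem derivesAxiom_alls_iff_ex {A : Set PreFormula} {M : List ℕ} (hM : M.Nodup) {i : ℕ}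
    (hi : i ∉ M) {φ L B : PreFormula}
    (h : alls M (and (imp φ (ex i (and L B))) (imp (ex i B) φ)) ∈ A) :
    DerivesAxiom A (alls M (iff φ (ex i B))) :=
  ⟨{_}, by simpa using h, 0, deriv_alls_iff_ex hM hi (by simp) (Finset.mem_insert_of_mem
    (Finset.mem_image_of_mem _ (Finset.mem_singleton_self _)))⟩

theorem derivesAxiom_sigmaOneInduction (A : Set PreFormula) {θ : PreFormula}
    (h : θ ∈ sigmaOneInduction) : DerivesAxiom A θ :=
  ⟨∅, by simp, 0, by simpa using deriv_sigmaOneInduction h⟩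

theorem exists_derivableIR_robinsonQPrime {ψ : PreFormula} (hψ : Proves ISigmaOne ψ) :
    ∃ T : Finset PreFormula, (T : Set PreFormula) ⊆ robinsonQPrime ∧
      DerivableIR (insert ψ (T.image neg)) := by
  refine exists_derivableIR (fun _ => isFormula_of_mem_robinsonQPrime) (fun θ hθ => ?_) hψ
  rcases hθ with (h | h) | h
  · exact derivesAxiom_of_mem (.inl h)
  · rw [Set.mem_singleton_iff.1 h]
    exact derivesAxiom_alls_iff_ex (by simp) (by simp) (.inr rfl)
  · exact derivesAxiom_sigmaOneInduction _ h

/-- The variant of `Q` in which the existential quantifiers on the right-hand sides of implications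
are bounded, both in the axiom about `≤` and in the one about predecessors. Unlike `Q'`, it consists
of sentences whose negations are `Σ`, which makes them true under the asymmetric interpretation for
all bounds. -/
def robinsonBounded : Set PreFormula :=
  equalityAxioms ∪
    { alls [0, 1] (imp (eqF x₀.succ x₁.succ) (eqF x₀ x₁)),
      alls [0] (eqF (x₀.add PreTerm.zero) x₀),
      alls [0, 1] (eqF (x₀.add x₁.succ) (x₀.add x₁).succ),
      alls [0] (eqF (x₀.mul PreTerm.zero) PreTerm.zero),
      alls [0, 1] (eqF (x₀.mul x₁.succ) ((x₀.mul x₁).add x₀)),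
      alls [0] (and (imp (eqF x₀ PreTerm.zero).neg (bex 1 x₀ (eqF x₀ x₁.succ)))
        (imp (ex 1 (eqF x₀ x₁.succ)) (eqF x₀ PreTerm.zero).neg)),
      alls [0, 1] (and (imp (leF x₀ x₁) (bex 2 x₁ (eqF (x₂.add x₀) x₁)))
        (imp (ex 2 (eqF (x₂.add x₀) x₁)) (leF x₀ x₁))) }

theorem isFormula_of_mem_robinsonBounded {θ : PreFormula} (h : θ ∈ robinsonBounded) :
    θ.IsFormula := by
  rcases h with h | h
  · exact isFormula_of_mem_equalityAxioms h
  · simp only [Set.mem_insert_iff, Set.mem_singleton_iff] at h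
    rcases h with rfl | rfl | rfl | rfl | rfl | rfl | rfl <;> exact isFormula_of_fv_eq_empty rfl

theorem exists_derivableIR_robinsonBounded {ψ : PreFormula} (hψ : Proves ISigmaOne ψ) :
    ∃ T : Finset PreFormula, (T : Set PreFormula) ⊆ robinsonBounded ∧
      DerivableIR (insert ψ (T.image neg)) := by
  refine exists_derivableIR (fun _ => isFormula_of_mem_robinsonBounded) (fun θ hθ => ?_) hψ
  rcases hθ with ((h | h) | h) | h
  · exact derivesAxiom_of_mem (.inl h)
  · simp only [robinsonCore, Set.mem_insert_iff, Set.mem_singleton_iff] at h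
    rcases h with rfl | rfl | h
    · exact derivesAxiom_of_mem (by simp [robinsonBounded])
    · exact derivesAxiom_alls_iff_ex (L := leF x₁ x₀) (by simp) (by simp)
        (by simp [robinsonBounded, bex])
    · refine derivesAxiom_of_mem ?_
      rcases h with rfl | rfl | rfl | rfl <;> simp [robinsonBounded]
  · rw [Set.mem_singleton_iff.1 h]
    exact derivesAxiom_alls_iff_ex (L := leF x₂ x₁) (by simp) (by simp)
      (by simp [robinsonBounded, bex])
  · exact derivesAxiom_sigmaOneInduction _ h

/-! ### Semantics of the asymmetric interpretation -/

namespace PreTerm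

theorem val_congr {η η' : ℕ → ℕ} {t : PreTerm} (h : ∀ n ∈ t.fv, η n = η' n) :
    t.val η = t.val η' := by
  induction t with
  | var n => exact h n (by simp [fv])
  | zero => rfl
  | succ t ih => simp only [val, ih h]
  | add s t ihs iht | mul s t ihs iht =>
    simp only [fv, Finset.mem_union] at h
    simp only [val, ihs fun n hn => h n (.inl hn), iht fun n hn => h n (.inr hn)]

theorem val_update {t : PreTerm} {k : ℕ} (h : k ∉ t.fv) (η : ℕ → ℕ) (a : ℕ) :
    t.val (Function.update η k a) = t.val η :=
  val_congr fun n hn => Function.update_of_ne (by rintro rfl; exact h hn) _ _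

theorem val_subst (t : PreTerm) (k : ℕ) (u : PreTerm) (η : ℕ → ℕ) :
    (t.subst k u).val η = t.val (Function.update η k (u.val η)) := by
  induction t with
  | var n =>
    by_cases h : n = k
    · simp [subst, val, h]
    · simp [subst, val, h]
  | zero => rfl
  | succ t ih => simp [subst, val, ih]
  | add s t ihs iht => simp [subst, val, ihs, iht]
  | mul s t ihs iht => simp [subst, val, ihs, iht]

@[simp] theorem val_numeral (n : ℕ) (η : ℕ → ℕ) : (numeral n).val η = n := by
  induction n <;> simp_all [numeral, val]

theorem val_mono {η η' : ℕ → ℕ} (h : ∀ n, η n ≤ η' n) (t : PreTerm) : t.val η ≤ t.val η' := by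
  induction t with
  | var n => exact h n
  | zero => exact le_rfl
  | succ t ih => exact Nat.succ_le_succ ih
  | add s t ihs iht => exact Nat.add_le_add ihs iht
  | mul s t ihs iht => exact Nat.mul_le_mul ihs iht

theorem primrec_val {α : Type} [Primcodable α] {e : α → ℕ → ℕ}
    (he : ∀ n, Primrec fun a => e a n) (t : PreTerm) : Primrec fun a => t.val (e a) := by
  induction t with
  | var n => exact he n
  | zero => exact Primrec.const 0
  | succ t ih => exact Primrec.succ.comp ih
  | add s t ihs iht => exact Primrec.nat_add.comp ihs iht
  | mul s t ihs iht => exact Primrec.nat_mul.comp ihs iht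

end PreTerm

namespace PreFormula

theorem isBoundedAll_eq_true {i : ℕ} {φ : PreFormula} (h : isBoundedAll i φ = true) :
    ∃ t ψ, φ = imp (leF (PreTerm.var (2 * i)) t) ψ ∧ 2 * i ∉ t.fv := by
  unfold isBoundedAll at h
  split at h
  · obtain ⟨rfl, ht⟩ := of_decide_eq_true h
    exact ⟨_, _, rfl, ht⟩
  · simp at h

theorem isBoundedEx_eq_true {i : ℕ} {φ : PreFormula} (h : isBoundedEx i φ = true) :
    ∃ t ψ, φ = and (leF (PreTerm.var (2 * i)) t) ψ ∧ 2 * i ∉ t.fv := by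
  unfold isBoundedEx at h
  split at h
  · obtain ⟨rfl, ht⟩ := of_decide_eq_true h
    exact ⟨_, _, rfl, ht⟩
  · simp at h

theorem isBoundedAll_neg (i : ℕ) (φ : PreFormula) :
    isBoundedAll i φ.neg = isBoundedEx i φ := by
  rw [Bool.eq_iff_iff]
  constructor <;> intro h
  · obtain ⟨t, ψ, hφ, ht⟩ := isBoundedAll_eq_true h
    rw [← neg_injective.eq_iff, PreFormula.neg_neg] at hφ
    simp [hφ, imp, leF, neg, isBoundedEx, ht]
  · obtain ⟨t, ψ, rfl, ht⟩ := isBoundedEx_eq_true h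
    simp [leF, neg, isBoundedAll, ht]

theorem isBoundedEx_neg (i : ℕ) (φ : PreFormula) :
    isBoundedEx i φ.neg = isBoundedAll i φ := by
  rw [← isBoundedAll_neg, PreFormula.neg_neg]

theorem isBoundedEx_subst {i k : ℕ} {u : PreTerm} (hu : u.IsTerm) (hk : k ≠ 2 * i)
    (φ : PreFormula) : isBoundedEx i (φ.subst k u) = isBoundedEx i φ := by
  rw [Bool.eq_iff_iff]
  constructor <;> intro h
  · obtain ⟨t, ψ, hφ, ht⟩ := isBoundedEx_eq_true h
    cases φ with
    | and φ₁ φ₂ =>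
      cases φ₁ with
      | atom R s s' =>
        simp only [subst, leF, PreFormula.and.injEq, PreFormula.atom.injEq] at hφ
        obtain ⟨⟨rfl, hs, rfl⟩, -⟩ := hφ
        have hs' : s = PreTerm.var (2 * i) := by
          cases s with
          | var n =>
            by_cases hn : n = k
            · simp only [PreTerm.subst, hn, if_true] at hs
              exact absurd (by simp [hs, PreTerm.fv]) (hu i)
            · simpa [PreTerm.subst, hn] using hs
          | _ => simp [PreTerm.subst] at hs
        have hs'' : 2 * i ∉ s'.fv := fun h' => by
          refine ht ?_
          clear * - h' hk
          induction s' with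
          | var n =>
            rw [PreTerm.fv, Finset.mem_singleton] at h'
            simp [PreTerm.subst, PreTerm.fv, ← h', hk.symm]
          | zero => exact h'
          | succ t ih => exact ih h'
          | add s t ihs iht | mul s t ihs iht =>
            simp only [PreTerm.subst, PreTerm.fv, Finset.mem_union] at h' ⊢
            exact h'.imp ihs iht
        simp [isBoundedEx, hs', hs'']
      | _ => simp [subst, leF] at hφ <;> split at hφ <;> simp at hφ
    | _ => simp [subst] at hφ <;> split at hφ <;> simp at hφ
  · obtain ⟨t, ψ, rfl, ht⟩ := isBoundedEx_eq_true h
    have ht' : 2 * i ∉ (t.subst k u).fv := fun h =>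
      (PreTerm.mem_fv_subst h).elim (fun h => ht h.1) (hu i)
    simp [subst, leF, isBoundedEx, PreTerm.subst, hk.symm, ht']

theorem isBoundedAll_subst {i k : ℕ} {u : PreTerm} (hu : u.IsTerm) (hk : k ≠ 2 * i)
    (φ : PreFormula) : isBoundedAll i (φ.subst k u) = isBoundedAll i φ := by
  rw [← isBoundedEx_neg, neg_subst, isBoundedEx_subst hu hk, isBoundedEx_neg]

theorem trueAt_asym_all {m n i : ℕ} {φ : PreFormula} {η : ℕ → ℕ} :
    (asym m n (all i φ)).TrueAt η ↔ ∀ a, (isBoundedAll i φ = false → a ≤ m) →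
      (asym m n φ).TrueAt (Function.update η (2 * i) a) := by
  by_cases h : isBoundedAll i φ = true
  · simp [asym, h, TrueAt]
  · simp [asym, h, TrueAt, ball, imp, leF, neg, RelSym.Holds, PreTerm.val, imp_iff_not_or]

theorem trueAt_asym_ex {m n i : ℕ} {φ : PreFormula} {η : ℕ → ℕ} :
    (asym m n (ex i φ)).TrueAt η ↔ ∃ a, (isBoundedEx i φ = false → a ≤ n) ∧
      (asym m n φ).TrueAt (Function.update η (2 * i) a) := by
  by_cases h : isBoundedEx i φ = true
  · simp [asym, h, TrueAt]
  · simp [asym, h, TrueAt, bex, leF, RelSym.Holds, PreTerm.val]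

theorem trueAt_asym_atom {m n : ℕ} {R : RelSym} {s t : PreTerm} {η : ℕ → ℕ} :
    (asym m n (atom R s t)).TrueAt η ↔ R.Holds (s.val η) (t.val η) :=
  Iff.rfl

theorem trueAt_asym_natom {m n : ℕ} {R : RelSym} {s t : PreTerm} {η : ℕ → ℕ} :
    (asym m n (natom R s t)).TrueAt η ↔ ¬R.Holds (s.val η) (t.val η) :=
  Iff.rfl

theorem trueAt_asym_and {m n : ℕ} {φ ψ : PreFormula} {η : ℕ → ℕ} :
    (asym m n (and φ ψ)).TrueAt η ↔ (asym m n φ).TrueAt η ∧ (asym m n ψ).TrueAt η :=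
  Iff.rfl

theorem trueAt_asym_or {m n : ℕ} {φ ψ : PreFormula} {η : ℕ → ℕ} :
    (asym m n (or φ ψ)).TrueAt η ↔ (asym m n φ).TrueAt η ∨ (asym m n ψ).TrueAt η :=
  Iff.rfl

theorem trueAt_asym_ball {m n i : ℕ} {t : PreTerm} (ht : 2 * i ∉ t.fv) {φ : PreFormula}
    {η : ℕ → ℕ} : (asym m n (ball i t φ)).TrueAt η ↔
      ∀ a ≤ t.val η, (asym m n φ).TrueAt (Function.update η (2 * i) a) := by
  rw [ball, trueAt_asym_all]
  simp [imp, leF, neg, isBoundedAll, ht, trueAt_asym_or, trueAt_asym_natom, RelSym.Holds,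
    PreTerm.val, PreTerm.val_update ht, imp_iff_not_or]

theorem trueAt_asym_bex {m n i : ℕ} {t : PreTerm} (ht : 2 * i ∉ t.fv) {φ : PreFormula}
    {η : ℕ → ℕ} : (asym m n (bex i t φ)).TrueAt η ↔
      ∃ a ≤ t.val η, (asym m n φ).TrueAt (Function.update η (2 * i) a) := by
  rw [bex, trueAt_asym_ex]
  simp [leF, isBoundedEx, ht, trueAt_asym_and, trueAt_asym_atom, RelSym.Holds,
    PreTerm.val, PreTerm.val_update ht]

theorem trueAt_asym_mono {m m' n n' : ℕ} (hm : m' ≤ m) (hn : n ≤ n') {φ : PreFormula}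
    {η : ℕ → ℕ} (h : (asym m n φ).TrueAt η) : (asym m' n' φ).TrueAt η := by
  induction φ generalizing η with
  | atom R s t => exact h
  | natom R s t => exact h
  | and φ ψ ihφ ihψ => exact ⟨ihφ h.1, ihψ h.2⟩
  | or φ ψ ihφ ihψ => exact h.imp ihφ ihψ
  | all i φ ih =>
    rw [trueAt_asym_all] at h ⊢
    exact fun a ha => ih (h a fun hb => (ha hb).trans hm)
  | ex i φ ih =>
    rw [trueAt_asym_ex] at h ⊢
    obtain ⟨a, ha, h⟩ := h
    exact ⟨a, fun hb => (ha hb).trans hn, ih h⟩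

theorem trueAt_asym_neg {m n : ℕ} {φ : PreFormula} {η : ℕ → ℕ} :
    (asym m n φ.neg).TrueAt η ↔ ¬(asym n m φ).TrueAt η := by
  induction φ generalizing η with
  | atom R s t => rfl
  | natom R s t => exact not_not.symm
  | and φ ψ ihφ ihψ =>
    simp only [neg, asym, TrueAt, ihφ, ihψ]
    tauto
  | or φ ψ ihφ ihψ =>
    simp only [neg, asym, TrueAt, ihφ, ihψ]
    tauto
  | all i φ ih =>
    rw [neg, trueAt_asym_ex, trueAt_asym_all]
    simp only [ih, isBoundedEx_neg]
    push Not
    rfl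
  | ex i φ ih =>
    rw [neg, trueAt_asym_ex, trueAt_asym_all]
    simp only [ih, isBoundedAll_neg]
    push Not
    rfl

/-- In a `Σ`-formula, no universal quantifier is affected by the asymmetric interpretation. -/
theorem IsSigma.trueAt_asym_congr {φ : PreFormula} (h : φ.IsSigma) {m m' n : ℕ} {η : ℕ → ℕ} :
    (asym m n φ).TrueAt η ↔ (asym m' n φ).TrueAt η := by
  induction h generalizing η with
  | atom R s t => rfl
  | natom R s t => rfl
  | and _ _ ihφ ihψ => exact and_congr ihφ ihψ
  | or _ _ ihφ ihψ => exact or_congr ihφ ihψ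
  | ball i t ht _ ih =>
    rw [trueAt_asym_ball ht, trueAt_asym_ball ht]
    simp only [ih]
  | bex i t ht _ ih =>
    rw [trueAt_asym_bex ht, trueAt_asym_bex ht]
    simp only [ih]
  | ex i _ ih => simp [trueAt_asym_ex, ih]

theorem IsSigma.trueAt_of_asym {φ : PreFormula} (h : φ.IsSigma) {m n : ℕ} {η : ℕ → ℕ}
    (hφ : (asym m n φ).TrueAt η) : φ.TrueAt η := by
  induction h generalizing η with
  | atom R s t => exact hφ
  | natom R s t => exact hφ
  | and _ _ ihφ ihψ => exact ⟨ihφ hφ.1, ihψ hφ.2⟩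
  | or _ _ ihφ ihψ => exact Or.imp ihφ ihψ hφ
  | ball i t ht _ ih =>
    intro a
    rw [PreFormula.ball, trueAt_asym_all] at hφ
    exact Or.imp_right ih (hφ a (by simp [imp, leF, neg, isBoundedAll, ht]))
  | bex i t ht _ ih =>
    rw [PreFormula.bex, trueAt_asym_ex] at hφ
    obtain ⟨a, -, ha, h⟩ := hφ
    exact ⟨a, ha, ih h⟩
  | ex i _ ih =>
    rw [trueAt_asym_ex] at hφ
    obtain ⟨a, -, h⟩ := hφ
    exact ⟨a, ih h⟩

theorem trueAt_asym_congr {m n : ℕ} {φ : PreFormula} {η η' : ℕ → ℕ}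
    (h : ∀ k ∈ φ.fv, η k = η' k) : (asym m n φ).TrueAt η ↔ (asym m n φ).TrueAt η' := by
  induction φ generalizing η η' with
  | atom R s t | natom R s t =>
    simp only [fv, Finset.mem_union] at h
    simp only [asym, TrueAt, PreTerm.val_congr fun n hn => h n (.inl hn),
      PreTerm.val_congr fun n hn => h n (.inr hn)]
  | and φ ψ ihφ ihψ =>
    simp only [fv, Finset.mem_union] at h
    exact and_congr (ihφ fun n hn => h n (.inl hn)) (ihψ fun n hn => h n (.inr hn))
  | or φ ψ ihφ ihψ =>
    simp only [fv, Finset.mem_union] at h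
    exact or_congr (ihφ fun n hn => h n (.inl hn)) (ihψ fun n hn => h n (.inr hn))
  | all i φ ih | ex i φ ih =>
    have key : ∀ a, (asym m n φ).TrueAt (Function.update η (2 * i) a) ↔
        (asym m n φ).TrueAt (Function.update η' (2 * i) a) := fun a => ih fun k hk => by
      by_cases hki : k = 2 * i
      · simp [hki]
      · simpa [hki] using h k (Finset.mem_erase.2 ⟨hki, hk⟩)
    simp only [trueAt_asym_all, trueAt_asym_ex, key]

theorem trueAt_asym_update {m n k a : ℕ} {φ : PreFormula} {η : ℕ → ℕ} (h : k ∉ φ.fv) :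
    (asym m n φ).TrueAt (Function.update η k a) ↔ (asym m n φ).TrueAt η :=
  trueAt_asym_congr fun l hl => Function.update_of_ne (by rintro rfl; exact h hl) _ _

theorem trueAt_asym_subst {m n k : ℕ} {φ : PreFormula} {u : PreTerm} (hu : u.IsTerm)
    {η : ℕ → ℕ} : (asym m n (φ.subst k u)).TrueAt η ↔
      (asym m n φ).TrueAt (Function.update η k (u.val η)) := by
  induction φ generalizing η with
  | atom R s t | natom R s t => simp [subst, asym, TrueAt, PreTerm.val_subst]
  | and φ ψ ihφ ihψ => exact and_congr ihφ ihψ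
  | or φ ψ ihφ ihψ => exact or_congr ihφ ihψ
  | all i φ ih | ex i φ ih =>
    by_cases hk : k = 2 * i
    · subst hk
      simp [subst, trueAt_asym_all, trueAt_asym_ex]
    · simp only [subst, hk, if_false, trueAt_asym_all, trueAt_asym_ex, isBoundedAll_subst hu hk,
        isBoundedEx_subst hu hk, ih, PreTerm.val_update (hu i), Function.update_comm hk]

/-- Instantiating a quantifier by an eigenvariable evaluates the matrix at an arbitrary value. -/
theorem trueAt_asym_subst_var {m n i k a : ℕ} {φ : PreFormula} (h : 2 * k + 1 ∉ (all i φ).fv)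
    {η : ℕ → ℕ} :
    (asym m n (φ.subst (2 * i) (PreTerm.var (2 * k + 1)))).TrueAt
        (Function.update η (2 * k + 1) a) ↔
      (asym m n φ).TrueAt (Function.update η (2 * i) a) := by
  rw [trueAt_asym_subst (PreTerm.isTerm_var k)]
  simp only [PreTerm.val, Function.update_self]
  rw [Function.update_comm (by omega), trueAt_asym_update]
  exact fun hk => h (Finset.mem_erase.2 ⟨by omega, hk⟩)

theorem trueAt_asym_bigOr {m n : ℕ} {Γ : Finset PreFormula} {η : ℕ → ℕ} :
    (asym m n (bigOr Γ)).TrueAt η ↔ ∃ φ ∈ Γ, (asym m n φ).TrueAt η := by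
  have key : ∀ L : List PreFormula,
      (asym m n (L.foldr or (natom RelSym.eq PreTerm.zero PreTerm.zero))).TrueAt η ↔
        ∃ φ ∈ L, (asym m n φ).TrueAt η := fun L => by
    induction L with
    | nil => simp [asym, TrueAt, RelSym.Holds]
    | cons φ L ih => simp [asym, TrueAt, ih]
  simp [bigOr, key]

end PreFormula

/-! ### Primitive recursive bounds for derivations with induction -/

/-- `⊨^g ⋁ Γ`, in terms of the elements of `Γ`. -/
def SeqTrue (g : ℕ → ℕ) (Γ : Finset PreFormula) : Prop :=
  ∀ (m : ℕ) (η : ℕ → ℕ), (∀ i, η i ≤ m) → ∃ φ ∈ Γ, (asym m (g m) φ).TrueAt η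

theorem exists_mem_trueAt_asym_mono {Γ Δ : Finset PreFormula} (hΓ : Γ ⊆ Δ) {m m' n n' : ℕ}
    (hm : m' ≤ m) (hn : n ≤ n') {η : ℕ → ℕ} (h : ∃ φ ∈ Γ, (asym m n φ).TrueAt η) :
    ∃ φ ∈ Δ, (asym m' n' φ).TrueAt η :=
  let ⟨φ, hφ, h⟩ := h
  ⟨φ, hΓ hφ, trueAt_asym_mono hm hn h⟩

theorem primrec_val_const (t : PreTerm) : Primrec fun m => t.val fun _ => m :=
  PreTerm.primrec_val (fun _ => Primrec.id) t

theorem update_le {m : ℕ} {η : ℕ → ℕ} (hη : ∀ i, η i ≤ m) {k a : ℕ} (ha : a ≤ m) (i : ℕ) :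
    Function.update η k a i ≤ m := by
  by_cases h : i = k
  · simpa [h] using ha
  · simpa [h] using hη i

/-- The values that matter for `∀ x φ` under the asymmetric interpretation are bounded: by `m` if
the quantifier is unbounded, and by the value of `t` if `φ` is `x ≤ t → ψ`. -/
theorem exists_primrec_relevant (i : ℕ) (φ : PreFormula) : ∃ T : ℕ → ℕ, Primrec T ∧
    ∀ m, m ≤ T m ∧ ∀ η : ℕ → ℕ, (∀ k, η k ≤ m) → ∀ a, (isBoundedAll i φ = false → a ≤ m) →
      a ≤ T m ∨ ∀ m' n, (asym m' n φ).TrueAt (Function.update η (2 * i) a) := by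
  by_cases h : isBoundedAll i φ = true
  · obtain ⟨t, ψ, rfl, ht⟩ := isBoundedAll_eq_true h
    refine ⟨fun m => m + t.val fun _ => m, Primrec.nat_add.comp Primrec.id (primrec_val_const t),
      fun m => ⟨Nat.le_add_right _ _, fun η hη a _ => ?_⟩⟩
    by_cases ha : a ≤ t.val η
    · exact .inl (ha.trans ((PreTerm.val_mono hη t).trans (Nat.le_add_left _ _)))
    · refine .inr fun m' n => .inl ?_
      simpa [leF, TrueAt, RelSym.Holds, neg, asym, PreTerm.val, PreTerm.val_update ht] using ha
  · exact ⟨id, Primrec.id, fun m => ⟨le_rfl, fun η _ a ha => .inl (ha (by simpa using h))⟩⟩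

theorem SeqTrue.all {g : ℕ → ℕ} (hg : Primrec g) {Γ Γ₀ : Finset PreFormula} {φ : PreFormula}
    {i k : ℕ} (hΓ : Γ₀ ⊆ Γ) (hk : 2 * k + 1 ∉ seqFV (insert (all i φ) Γ₀))
    (h : SeqTrue g (insert (φ.subst (2 * i) (PreTerm.var (2 * k + 1))) Γ₀)) :
    ∃ g, Primrec g ∧ SeqTrue g (insert (all i φ) Γ) := by
  simp only [seqFV, Finset.mem_biUnion, Finset.mem_insert, not_exists, not_and, forall_eq_or_imp]
    at hk
  obtain ⟨T, hT, hT'⟩ := exists_primrec_relevant i φ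
  refine ⟨fun m => g (T m), hg.comp hT, fun m η hη => ?_⟩
  by_cases hφ : (asym m (g (T m)) (PreFormula.all i φ)).TrueAt η
  · exact ⟨_, Finset.mem_insert_self _ _, hφ⟩
  rw [trueAt_asym_all] at hφ
  push Not at hφ
  obtain ⟨a, ha, hφ⟩ := hφ
  have ha' := ((hT' m).2 η hη a ha).resolve_right fun h => hφ (h _ _)
  obtain ⟨ψ, hψ, h⟩ := h (T m) (Function.update η (2 * k + 1) a)
    (update_le (fun i => (hη i).trans (hT' m).1) ha')
  rcases Finset.mem_insert.1 hψ with rfl | hψ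
  · rw [trueAt_asym_subst_var hk.1] at h
    exact absurd (trueAt_asym_mono (hT' m).1 le_rfl h) hφ
  · rw [trueAt_asym_update (hk.2 ψ hψ)] at h
    exact ⟨ψ, Finset.mem_insert_of_mem (hΓ hψ), trueAt_asym_mono (hT' m).1 le_rfl h⟩

theorem SeqTrue.ex {g : ℕ → ℕ} (hg : Primrec g) {Γ : Finset PreFormula} {φ : PreFormula}
    {i : ℕ} {t : PreTerm} (ht : t.IsTerm) (h : SeqTrue g (insert (φ.subst (2 * i) t) Γ)) :
    ∃ g, Primrec g ∧ SeqTrue g (insert (ex i φ) Γ) := by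
  refine ⟨fun m => g m + t.val fun _ => m, Primrec.nat_add.comp hg (primrec_val_const t),
    fun m η hη => ?_⟩
  obtain ⟨ψ, hψ, h⟩ := h m η hη
  have h := trueAt_asym_mono le_rfl (Nat.le_add_right (g m) (t.val fun _ => m)) h
  rcases Finset.mem_insert.1 hψ with rfl | hψ
  · rw [trueAt_asym_subst ht] at h
    refine ⟨_, Finset.mem_insert_self _ _, trueAt_asym_ex.2 ⟨t.val η, fun _ => ?_, h⟩⟩
    exact (PreTerm.val_mono hη t).trans (Nat.le_add_left _ _)
  · exact ⟨ψ, Finset.mem_insert_of_mem hψ, h⟩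

/-- The bounds of the two premises of a cut are composed: the bound for the witnesses of a
`Σ`-formula `φ` is one for the universal quantifiers of `¬φ`. -/
theorem SeqTrue.cut {g h : ℕ → ℕ} (hg : Primrec g) (hh : Primrec h) {Γ : Finset PreFormula}
    {φ : PreFormula} (hφ : φ.IsSigma) (h₁ : SeqTrue g (insert φ Γ))
    (h₂ : SeqTrue h (insert φ.neg Γ)) : ∃ g, Primrec g ∧ SeqTrue g Γ := by
  have hM : Primrec fun m => m + g m := Primrec.nat_add.comp Primrec.id hg
  refine ⟨fun m => g m + h (m + g m), Primrec.nat_add.comp hg (hh.comp hM), fun m η hη => ?_⟩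
  obtain ⟨ψ, hψ, hψ₁⟩ := h₁ m η hη
  rcases Finset.mem_insert.1 hψ with rfl | hψ
  · obtain ⟨χ, hχ, h₂⟩ := h₂ (m + g m) η fun i => (hη i).trans (Nat.le_add_right _ _)
    rcases Finset.mem_insert.1 hχ with rfl | hχ
    · rw [trueAt_asym_neg, hφ.trueAt_asym_congr (m' := m)] at h₂
      exact absurd (trueAt_asym_mono le_rfl (Nat.le_add_left _ _) hψ₁) h₂
    · exact ⟨χ, hχ, trueAt_asym_mono (Nat.le_add_right _ _) (Nat.le_add_left _ _) h₂⟩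
  · exact ⟨ψ, hψ, trueAt_asym_mono le_rfl (Nat.le_add_right _ _) hψ₁⟩

/-- The bound of the premise of the induction rule is iterated: a bound for the witnesses of
`φ(0)`, which is provided by the universal quantifiers of `¬φ(0)`, is turned into bounds for the
witnesses of `φ(1)`, `φ(2)`, … up to the value of `t`. -/
theorem SeqTrue.ir {g : ℕ → ℕ} (hg : Primrec g) {Γ Γ₀ : Finset PreFormula} {φ : PreFormula}
    {i k : ℕ} {t : PreTerm} (hφ : φ.IsSigma) (ht : t.IsTerm) (hΓ : Γ₀ ⊆ Γ)
    (hk : 2 * k + 1 ∉ seqFV (insert (PreFormula.all i φ) Γ₀))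
    (h : SeqTrue g (insert (φ.subst (2 * i) (PreTerm.var (2 * k + 1))).neg
      (insert (φ.subst (2 * i) (PreTerm.succ (PreTerm.var (2 * k + 1)))) Γ₀))) :
    ∃ g, Primrec g ∧ SeqTrue g (insert (φ.subst (2 * i) PreTerm.zero).neg
      (insert (φ.subst (2 * i) t) Γ)) := by
  simp only [seqFV, Finset.mem_biUnion, Finset.mem_insert, not_exists, not_and, forall_eq_or_imp]
    at hk
  set T : ℕ → ℕ := fun m => t.val fun _ => m with hTdef
  have hT : Primrec T := primrec_val_const t
  set F : ℕ → ℕ := fun x => x + g x with hFdef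
  set H : ℕ → ℕ → ℕ := fun m b => F^[b] (m + T m) with hHdef
  have hF : Primrec F := Primrec.nat_add.comp Primrec.id hg
  have hstep : ∀ m b, H m (b + 1) = H m b + g (H m b) := fun m b => by
    simp only [hHdef, Function.iterate_succ_apply', hFdef]
  have hmono : ∀ m, Monotone (H m) := fun m =>
    monotone_nat_of_le_succ fun b => by rw [hstep]; exact Nat.le_add_right _ _
  have hbase : ∀ m b, m + T m ≤ H m b := fun m b => hmono m (Nat.zero_le b)
  refine ⟨fun m => H m (T m), Primrec.nat_iterate hT (Primrec.nat_add.comp Primrec.id hT)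
    (hF.comp Primrec.snd), fun m η hη => ?_⟩
  have htT : t.val η ≤ T m := PreTerm.val_mono hη t
  by_cases h₀ : (asym m (H m (T m)) (φ.subst (2 * i) PreTerm.zero).neg).TrueAt η
  · exact ⟨_, Finset.mem_insert_self _ _, h₀⟩
  by_cases hΓ' : ∃ ψ ∈ Γ, (asym m (H m (T m)) ψ).TrueAt η
  · obtain ⟨ψ, hψ, h'⟩ := hΓ'
    exact ⟨ψ, by simp [hψ], h'⟩
  rw [trueAt_asym_neg, not_not, trueAt_asym_subst PreTerm.isTerm_zero] at h₀
  have key : ∀ b, b ≤ T m → (asym m (H m b) φ).TrueAt (Function.update η (2 * i) b) := by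
    intro b
    induction b with
    | zero =>
      intro _
      rw [hφ.trueAt_asym_congr (m' := H m (T m))]
      exact trueAt_asym_mono le_rfl ((Nat.le_add_right _ _).trans (hbase m 0)) h₀
    | succ b ih =>
      intro hb
      have hφb := ih (by omega)
      have hmH : m ≤ H m b := (Nat.le_add_right _ _).trans (hbase m b)
      obtain ⟨ψ, hψ, h⟩ := h (H m b) (Function.update η (2 * k + 1) b)
        (update_le (fun i => (hη i).trans hmH)
          ((Nat.le_of_succ_le hb).trans ((Nat.le_add_left _ _).trans (hbase m b))))
      have hgH : g (H m b) ≤ H m (b + 1) := by rw [hstep]; exact Nat.le_add_left _ _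
      rcases Finset.mem_insert.1 hψ with rfl | hψ
      · rw [trueAt_asym_neg, trueAt_asym_subst_var hk.1, hφ.trueAt_asym_congr (m' := m)] at h
        exact absurd hφb h
      rcases Finset.mem_insert.1 hψ with rfl | hψ
      · rw [trueAt_asym_subst (PreTerm.isTerm_var k).succ] at h
        simp only [PreTerm.val, Function.update_self] at h
        rw [Function.update_comm (by omega), trueAt_asym_update] at h
        · exact trueAt_asym_mono hmH hgH h
        · exact fun h' => hk.1 (Finset.mem_erase.2 ⟨by omega, h'⟩)
      · rw [trueAt_asym_update (hk.2 ψ hψ)] at h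
        exact absurd ⟨ψ, hΓ hψ, trueAt_asym_mono hmH (hgH.trans (hmono m hb)) h⟩ hΓ'
  refine ⟨φ.subst (2 * i) t, by simp, ?_⟩
  rw [trueAt_asym_subst ht]
  exact trueAt_asym_mono le_rfl (hmono m htT) (key _ htT)

theorem DerivableIR.exists_seqTrue {Γ : Finset PreFormula} (h : DerivableIR Γ) :
    ∃ g, Primrec g ∧ SeqTrue g Γ := by
  induction h with
  | ax φ _ _ h₁ h₂ =>
    refine ⟨id, Primrec.id, fun m η _ => ?_⟩
    by_cases h : (asym m m φ).TrueAt η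
    · exact ⟨φ, h₁, h⟩
    · exact ⟨φ.neg, h₂, trueAt_asym_neg.2 h⟩
  | and _ _ ih₁ ih₂ =>
    obtain ⟨g₁, hg₁, h₁⟩ := ih₁
    obtain ⟨g₂, hg₂, h₂⟩ := ih₂
    refine ⟨fun m => g₁ m + g₂ m, Primrec.nat_add.comp hg₁ hg₂, fun m η hη => ?_⟩
    have h₁ := exists_mem_trueAt_asym_mono subset_rfl le_rfl (Nat.le_add_right (g₁ m) (g₂ m))
      (h₁ m η hη)
    have h₂ := exists_mem_trueAt_asym_mono subset_rfl le_rfl (Nat.le_add_left (g₂ m) (g₁ m))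
      (h₂ m η hη)
    simp only [Finset.exists_mem_insert, asym, TrueAt] at h₁ h₂ ⊢
    tauto
  | orLeft _ _ ih =>
    obtain ⟨g, hg, h⟩ := ih
    refine ⟨g, hg, fun m η hη => ?_⟩
    have h := h m η hη
    simp only [Finset.exists_mem_insert, asym, TrueAt] at h ⊢
    tauto
  | orRight _ _ ih =>
    obtain ⟨g, hg, h⟩ := ih
    refine ⟨g, hg, fun m η hη => ?_⟩
    have h := h m η hη
    simp only [Finset.exists_mem_insert, asym, TrueAt] at h ⊢
    tauto
  | all k _ hΓ hk _ ih =>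
    obtain ⟨g, hg, h⟩ := ih
    exact h.all hg hΓ hk
  | ex t _ ht _ ih =>
    obtain ⟨g, hg, h⟩ := ih
    exact h.ex hg ht
  | sigmaCut φ _ hφ _ _ ih₁ ih₂ =>
    obtain ⟨g₁, hg₁, h₁⟩ := ih₁
    obtain ⟨g₂, hg₂, h₂⟩ := ih₂
    exact h₁.cut hg₁ hg₂ hφ h₂
  | ir φ i k t hφ _ ht _ hΓ hk _ ih =>
    obtain ⟨g, hg, h⟩ := ih
    exact h.ir hg hφ ht hΓ hk

theorem DerivableIR.exists_asymTrueFun {Γ : Finset PreFormula} (h : DerivableIR Γ) :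
    ∃ g : ℕ → ℕ, Nat.Primrec g ∧ AsymTrueFun g (bigOr Γ) := by
  obtain ⟨g, hg, h⟩ := h.exists_seqTrue
  exact ⟨g, Primrec.nat_iff.1 hg, fun m η hη => trueAt_asym_bigOr.2 (h m η hη)⟩

/-! ### Provably total functions -/

theorem trueAt_asym_of_mem_robinsonBounded {θ : PreFormula} (h : θ ∈ robinsonBounded) (m n : ℕ)
    (η : ℕ → ℕ) : (asym m n θ).TrueAt η := by
  rcases h with h | h
  · simp only [equalityAxioms, Set.mem_insert_iff, Set.mem_singleton_iff] at h
    rcases h with rfl | rfl | rfl | rfl | rfl | rfl | rfl | rfl | rfl <;>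
      simp [alls, imp, PreFormula.iff, neg, eqF, leF, trueAt_asym_all, trueAt_asym_or,
        trueAt_asym_and, trueAt_asym_atom, trueAt_asym_natom, RelSym.Holds, PreTerm.val,
        isBoundedAll] <;> grind
  · simp only [Set.mem_insert_iff, Set.mem_singleton_iff] at h
    rcases h with rfl | rfl | rfl | rfl | rfl | rfl | rfl
    all_goals
      simp [alls, imp, neg, eqF, leF, bex, trueAt_asym_all, trueAt_asym_ex, trueAt_asym_or,
        trueAt_asym_and, trueAt_asym_atom, trueAt_asym_natom, isBoundedAll, isBoundedEx,
        RelSym.Holds, PreTerm.val, PreTerm.fv]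
    · exact fun a _ b _ => (em (a = b)).symm
    · exact fun _ _ _ _ => rfl
    · exact fun _ _ _ _ => rfl
    · refine fun a _ => ⟨?_, ?_⟩
      · cases a with
        | zero => exact .inl rfl
        | succ b => exact .inr ⟨b, Nat.le_succ b, rfl⟩
      · by_cases ha : a = 0
        · exact .inl fun b _ => by omega
        · exact .inr ha
    · refine fun a _ b _ => ⟨?_, ?_⟩
      · by_cases hab : a ≤ b
        · exact .inr ⟨b - a, Nat.sub_le b a, Nat.sub_add_cancel hab⟩
        · exact .inl (not_le.1 hab)
      · by_cases hab : a ≤ b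
        · exact .inr hab
        · exact .inl fun c _ => by omega

theorem primrecPred_forall_le {α : Type} [Primcodable α] {p : α × ℕ → Prop}
    (hp : PrimrecPred p) {n : α → ℕ} (hn : Primrec n) : PrimrecPred fun a => ∀ x ≤ n a,
      p (a, x) :=
  ((PrimrecRel.forall_mem_list (R := fun x a => p (a, x))
    (hp.comp (Primrec.snd.pair Primrec.fst))).comp
    (Primrec.list_range.comp (Primrec.succ.comp hn)) Primrec.id).of_eq fun a => by
      simp

theorem primrecPred_exists_le {α : Type} [Primcodable α] {p : α × ℕ → Prop}
    (hp : PrimrecPred p) {n : α → ℕ} (hn : Primrec n) : PrimrecPred fun a => ∃ x ≤ n a,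
      p (a, x) :=
  ((PrimrecRel.exists_mem_list (R := fun x a => p (a, x))
    (hp.comp (Primrec.snd.pair Primrec.fst))).comp
    (Primrec.list_range.comp (Primrec.succ.comp hn)) Primrec.id).of_eq fun a => by
      simp

theorem primrec_update {α : Type} [Primcodable α] {e : α → ℕ → ℕ}
    (he : ∀ k, Primrec fun a => e a k) (l k : ℕ) :
    Primrec fun p : α × ℕ => Function.update (e p.1) l p.2 k := by
  by_cases h : k = l
  · simpa [h] using Primrec.snd
  · simpa [h] using (he k).comp Primrec.fst

theorem primrecPred_holds (R : RelSym) {α : Type} [Primcodable α] {f g : α → ℕ} (hf : Primrec f)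
    (hg : Primrec g) : PrimrecPred fun a => R.Holds (f a) (g a) := by
  cases R with
  | eq => exact Primrec.eq.comp hf hg
  | le => exact Primrec.nat_le.comp hf hg

/-- Predicates defined by `Σ`-formulas whose unbounded quantifiers are bounded by a primitive
recursive function are primitive recursive. The assignment `e a` depends on a parameter `a` of
arbitrary type, so that the induction can pass from `a` to pairs `(a, x)` at a quantifier. -/
theorem PreFormula.IsSigma.primrecPred {φ : PreFormula} (hφ : φ.IsSigma) (m : ℕ) {α : Type}
    [Primcodable α] {e : α → ℕ → ℕ} (he : ∀ k, Primrec fun a => e a k) {n : α → ℕ}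
    (hn : Primrec n) : PrimrecPred fun a => (asym m (n a) φ).TrueAt (e a) := by
  induction hφ generalizing α with
  | atom R s t => exact primrecPred_holds R (PreTerm.primrec_val he s) (PreTerm.primrec_val he t)
  | natom R s t =>
    exact (primrecPred_holds R (PreTerm.primrec_val he s) (PreTerm.primrec_val he t)).not
  | and _ _ ihφ ihψ => exact (ihφ he hn).and (ihψ he hn)
  | or _ _ ihφ ihψ => exact (ihφ he hn).or (ihψ he hn)
  | ball i t ht _ ih =>
    simp only [trueAt_asym_ball ht]
    exact primrecPred_forall_le (ih (primrec_update he (2 * i)) (hn.comp Primrec.fst))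
      (PreTerm.primrec_val he t)
  | bex i t ht _ ih =>
    simp only [trueAt_asym_bex ht]
    exact primrecPred_exists_le (ih (primrec_update he (2 * i)) (hn.comp Primrec.fst))
      (PreTerm.primrec_val he t)
  | @ex φ i _ ih =>
    -- The quantifier may be a bounded one, in which case `n` does not bound the witnesses.
    have ih := ih (primrec_update he (2 * i)) (hn.comp Primrec.fst)
    by_cases h : isBoundedEx i φ = true
    · obtain ⟨t, ψ, rfl, ht⟩ := isBoundedEx_eq_true h
      refine (primrecPred_exists_le ih (PreTerm.primrec_val he t)).of_eq fun a => ?_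
      refine Iff.trans (exists_congr fun x => and_congr_right fun hx => ?_)
        (trueAt_asym_bex ht).symm
      simp [leF, trueAt_asym_and, trueAt_asym_atom, RelSym.Holds, PreTerm.val,
        PreTerm.val_update ht, hx]
    · refine (primrecPred_exists_le ih hn).of_eq fun a => ?_
      simp [trueAt_asym_ex, h]

theorem ProvablyTotal.primrec {f : ℕ → ℕ} (hf : ProvablyTotal ISigmaOne f) : Nat.Primrec f := by
  obtain ⟨φ, i, j, hij, hφ, -, hdef, hprov⟩ := hf
  obtain ⟨T, hT, hder⟩ := exists_derivableIR_robinsonBounded hprov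
  obtain ⟨g, hg, hgT⟩ := hder.exists_seqTrue
  have hσ := hφ.isSigma
  set e : ℕ × ℕ → ℕ → ℕ := fun p =>
    Function.update (Function.update (fun _ => 0) (2 * i) p.1) (2 * j) p.2 with hedef
  have hei : ∀ p, e p (2 * i) = p.1 := fun p => by
    simp [hedef, Function.update_of_ne (show 2 * i ≠ 2 * j by omega)]
  have hej : ∀ p, e p (2 * j) = p.2 := fun p => by simp [hedef]
  have he : ∀ k, Primrec fun p => e p k := fun k => by
    by_cases hj : k = 2 * j
    · simpa [hedef, hj] using Primrec.snd
    by_cases hi : k = 2 * i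
    · simpa [hedef, Function.update_of_ne hj, hi, hij] using Primrec.fst
    · simpa [hedef, Function.update_of_ne hj, Function.update_of_ne hi] using Primrec.const 0
  have hsound : ∀ a b, (asym 0 (g a) φ).TrueAt (e (a, b)) → f a = b := fun a b h =>
    (hdef a b _ (hei _) (hej _)).2 (hσ.trueAt_of_asym h)
  have hex : ∀ a, ∃ b ≤ g a, (asym 0 (g a) φ).TrueAt (e (a, b)) := fun a => by
    obtain ⟨ψ, hψ, h⟩ := hgT a (fun _ => 0) fun _ => Nat.zero_le _
    rcases Finset.mem_insert.1 hψ with rfl | hψ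
    · rw [trueAt_asym_all] at h
      have h := h a fun _ => le_rfl
      rw [trueAt_asym_ex] at h
      obtain ⟨b, hb, h⟩ := h
      refine ⟨b, hb ?_, hσ.trueAt_asym_congr.1 h⟩
      obtain ⟨k, θ, -, rfl⟩ := hφ
      rfl
    · obtain ⟨θ, hθ, rfl⟩ := Finset.mem_image.1 hψ
      rw [trueAt_asym_neg] at h
      exact absurd (trueAt_asym_of_mem_robinsonBounded (hT hθ) _ _ _) h
  classical
  have hrel : PrimrecRel fun a b => (asym 0 (g a) φ).TrueAt (e (a, b)) :=
    hσ.primrecPred 0 he (hg.comp Primrec.fst)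
  refine Primrec.nat_iff.1 ((Primrec.nat_findGreatest hg hrel).of_eq fun a => ?_)
  obtain ⟨b, hb, h⟩ := hex a
  exact (hsound a _ (Nat.findGreatest_spec
    (P := fun b => (asym 0 (g a) φ).TrueAt (e (a, b))) hb h)).symm

end FOArith

theorem mainTheorem3 :
    (∀ ψ : FOArith.PreFormula, FOArith.Proves FOArith.ISigmaOne ψ →
      ∃ T : Finset FOArith.PreFormula, (T : Set FOArith.PreFormula) ⊆ FOArith.robinsonQPrime ∧
        FOArith.DerivableIR (insert ψ (T.image FOArith.PreFormula.neg))) ∧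
    (∀ Γ : Finset FOArith.PreFormula, FOArith.DerivableIR Γ →
      ∃ g : ℕ → ℕ, Nat.Primrec g ∧ FOArith.PreFormula.AsymTrueFun g (FOArith.bigOr Γ)) ∧
    (∀ f : ℕ → ℕ, FOArith.ProvablyTotal FOArith.ISigmaOne f →
      Nat.Primrec f ∧ ∃ g : ℕ → ℕ, Nat.Primrec g ∧ ∀ n : ℕ, f n ≤ g n) :=
  ⟨fun _ => FOArith.exists_derivableIR_robinsonQPrime,
    fun _ => FOArith.DerivableIR.exists_asymTrueFun,
    fun f hf => ⟨hf.primrec, f, hf.primrec, fun _ => le_rfl⟩⟩
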